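/- Let $N\ge 1$, let $\Omega\subset\mathbb R^N$ be a bounded open set, let $\beta>1$, let $f\in L^1(\Omega)$ be nonnegative, and put $q:=\max\{1,\frac{\beta+1}{2}\}$. A function $u\in H^1_{loc}(\Omega)$ is called a solution of $$-\Delta u=\frac{f}{u^\beta},\quad u>0\quad\text{in }\Omega \qquad (P)$$ if $\operatorname{ess\,inf}_K u>0$ for every compact $K\subset\Omega$ and $\int_\Omega\nabla u\cdot\nabla\varphi\,dx=\int_\Omega\frac{f}{u^\beta}\varphi\,dx$ for all $\varphi\in C^1_c(\Omega)$. Let $\mathcal C$ be the class of functions $u\in H^1_{loc}(\Omega)$ with $u^q\in H^1_0(\Omega)$. Then: 1. If $u\in\mathcal C$ and $u\ge 0$ a.e. in $\Omega$, then $u=0$ on $\partial\Omega$ in the sense that $(u-\varepsilon)^+\in H^1_0(\Omega)$ for every $\varepsilon>0$. 2. If $u,v\in\mathcal C$ are two solutions of $(P)$, then $u=v$ a.e. in $\Omega$. 3. In particular, let $u$ be a Boccardo–Orsina solution, i.e. a solution of $(P)$ in $\mathcal C$ that is the a.e. limit in $\Omega$ of nonnegative weak solutions $u_n\in H^1_0(\Omega)$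 ($n\ge1$) of $-\Delta u_n=\min\{f,n\}\,(u_n+\frac1n)^{-\beta}$ in $\Omega$. Then $u=0$ on $\partial\Omega$ in the sense of 1, and a function $v$ is a solution of $(P)$ in $\mathcal C$ if and only if $v=u$ a.e. in $\Omega$. -/

import Mathlib

open MeasureTheory Filter Topology TopologicalSpace

/-- `g` is the weak gradient of `u` in the open set `Ω`: both are locally integrable in `Ω` and
`∫_Ω u ∂ᵢφ = - ∫_Ω gᵢ φ` for every `φ ∈ C^∞_c(Ω)` and every index `i`. -/
structure IsWeakGradient {N : ℕ} (Ω : Opens (EuclideanSpace ℝ (Fin N)))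
    (u : EuclideanSpace ℝ (Fin N) → ℝ)
    (g : EuclideanSpace ℝ (Fin N) → EuclideanSpace ℝ (Fin N)) : Prop where
  locallyIntegrableOn_fun : LocallyIntegrableOn u Ω volume
  locallyIntegrableOn_grad : LocallyIntegrableOn g Ω volume
  integral_eq : ∀ (φ : TestFunction Ω ℝ ⊤) (i : Fin N),
    ∫ x in (Ω : Set (EuclideanSpace ℝ (Fin N))), u x * (gradient φ x) i =
      -∫ x in (Ω : Set (EuclideanSpace ℝ (Fin N))), g x i * φ x

/-- `u ∈ H¹_loc(Ω)`: `u` has a weak gradient in `Ω`, and `u` and its weak gradient are square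
integrable on every compact subset of `Ω`. -/
def MemH1Loc {N : ℕ} (Ω : Opens (EuclideanSpace ℝ (Fin N)))
    (u : EuclideanSpace ℝ (Fin N) → ℝ) : Prop :=
  ∃ g : EuclideanSpace ℝ (Fin N) → EuclideanSpace ℝ (Fin N), IsWeakGradient Ω u g ∧
    ∀ K : Set (EuclideanSpace ℝ (Fin N)), IsCompact K → K ⊆ Ω →
      MemLp u 2 (volume.restrict K) ∧ MemLp g 2 (volume.restrict K)

/-- `u ∈ H¹₀(Ω)`: `u` belongs to `H¹(Ω)` (`u` and its weak gradient `g` are in `L²(Ω)`) and it is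
the limit in `H¹(Ω)` of a sequence of functions of `C^∞_c(Ω)`. -/
def MemH10 {N : ℕ} (Ω : Opens (EuclideanSpace ℝ (Fin N)))
    (u : EuclideanSpace ℝ (Fin N) → ℝ) : Prop :=
  ∃ g : EuclideanSpace ℝ (Fin N) → EuclideanSpace ℝ (Fin N), IsWeakGradient Ω u g ∧
    MemLp u 2 (volume.restrict Ω) ∧ MemLp g 2 (volume.restrict Ω) ∧
    ∃ φ : ℕ → TestFunction Ω ℝ ⊤,
      Tendsto (fun n => eLpNorm (fun x => φ n x - u x) 2 (volume.restrict Ω)) atTop (𝓝 0) ∧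
      Tendsto (fun n => eLpNorm (fun x => gradient (φ n) x - g x) 2 (volume.restrict Ω))
        atTop (𝓝 0)

/-- `-Δu = h` in `Ω` in the weak distributional meaning: `∫_Ω ∇u·∇φ = ∫_Ω h φ` for every
`φ ∈ C¹_c(Ω)`, where `∇u` is the weak gradient of `u` (it is unique up to null sets). The
definition is used for `u ∈ H¹_loc(Ω)` and `h ∈ L¹_loc(Ω)` only. -/
def SolvesWeakly {N : ℕ} (Ω : Opens (EuclideanSpace ℝ (Fin N)))
    (u h : EuclideanSpace ℝ (Fin N) → ℝ) : Prop :=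
  ∃ g : EuclideanSpace ℝ (Fin N) → EuclideanSpace ℝ (Fin N), IsWeakGradient Ω u g ∧
    ∀ φ : TestFunction Ω ℝ 1,
      ∫ x in (Ω : Set (EuclideanSpace ℝ (Fin N))), inner ℝ (g x) (gradient φ x) =
        ∫ x in (Ω : Set (EuclideanSpace ℝ (Fin N))), h x * φ x

/-- `u > 0` in `Ω` in the sense that `ess inf_K u > 0` for every compact `K ⊆ Ω`. -/
def IsPositiveIn {N : ℕ} (Ω : Opens (EuclideanSpace ℝ (Fin N)))
    (u : EuclideanSpace ℝ (Fin N) → ℝ) : Prop :=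
  ∀ K : Set (EuclideanSpace ℝ (Fin N)), IsCompact K → K ⊆ Ω →
    ∃ c : ℝ, 0 < c ∧ ∀ᵐ x ∂(volume.restrict K), c ≤ u x

/-- `u ∈ H¹_loc(Ω)` is a weak solution of `-Δu = f / u^β`, `u > 0` in `Ω`. -/
structure IsSingularSolution {N : ℕ} (Ω : Opens (EuclideanSpace ℝ (Fin N))) (β : ℝ)
    (f u : EuclideanSpace ℝ (Fin N) → ℝ) : Prop where
  memH1Loc : MemH1Loc Ω u
  pos : IsPositiveIn Ω u
  weak : SolvesWeakly Ω u (fun x => f x / u x ^ β)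

/-- `u ∈ H¹_loc(Ω)` and `u^q ∈ H¹₀(Ω)`, where `q = max {1, (β + 1) / 2}`. -/
def InBoccardoOrsinaClass {N : ℕ} (Ω : Opens (EuclideanSpace ℝ (Fin N))) (β : ℝ)
    (u : EuclideanSpace ℝ (Fin N) → ℝ) : Prop :=
  MemH1Loc Ω u ∧ MemH10 Ω (fun x => u x ^ max 1 ((β + 1) / 2))

/-- `u = 0` on `∂Ω`: `u` is nonnegative in `Ω` and `(u - ε)⁺ ∈ H¹₀(Ω)` for every `ε > 0`. -/
def VanishesOnBoundary {N : ℕ} (Ω : Opens (EuclideanSpace ℝ (Fin N)))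
    (u : EuclideanSpace ℝ (Fin N) → ℝ) : Prop :=
  (∀ᵐ x ∂(volume.restrict (Ω : Set (EuclideanSpace ℝ (Fin N)))), 0 ≤ u x) ∧
    ∀ ε : ℝ, 0 < ε → MemH10 Ω (fun x => max (u x - ε) 0)

/-- `w ∈ H¹₀(Ω)` is a nonnegative weak solution of the regularized problem
`-Δw = fₙ / (w + 1/n)^β` with the truncated datum `fₙ = min {f, n}`. -/
structure IsApproximateSolution {N : ℕ} (Ω : Opens (EuclideanSpace ℝ (Fin N))) (β : ℝ)
    (f : EuclideanSpace ℝ (Fin N) → ℝ) (n : ℕ) (w : EuclideanSpace ℝ (Fin N) → ℝ) : Prop where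
  memH10 : MemH10 Ω w
  nonneg : ∀ᵐ x ∂(volume.restrict (Ω : Set (EuclideanSpace ℝ (Fin N)))), 0 ≤ w x
  weak : SolvesWeakly Ω w (fun x => min (f x) n / (w x + 1 / (n : ℝ)) ^ β)

/-- `u` is a Boccardo–Orsina solution: a solution of the singular problem with `u ∈ H¹_loc(Ω)` and
`u^q ∈ H¹₀(Ω)` which is the a.e. limit of solutions `wₙ` of the regularized problems, `n ≥ 1`. -/
structure IsBoccardoOrsinaSolution {N : ℕ} (Ω : Opens (EuclideanSpace ℝ (Fin N))) (β : ℝ)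
    (f u : EuclideanSpace ℝ (Fin N) → ℝ) : Prop where
  isSolution : IsSingularSolution Ω β f u
  inClass : InBoccardoOrsinaClass Ω β u
  isLimit : ∃ w : ℕ → EuclideanSpace ℝ (Fin N) → ℝ,
    (∀ n : ℕ, 1 ≤ n → IsApproximateSolution Ω β f n (w n)) ∧
    ∀ᵐ x ∂(volume.restrict (Ω : Set (EuclideanSpace ℝ (Fin N)))),
      Tendsto (fun n => w n x) atTop (𝓝 (u x))

/-! Boundary values. Since `(u - ε)⁺ = max (u ^ q) (ε ^ q) ^ (1 / q) - ε` and `1 / q ≤ 1`, the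
function `(u - ε)⁺` is a Lipschitz function of `u ^ q` that vanishes at `0`. It therefore inherits
membership in `H¹₀` (`MemH10.comp`, `memH10_sub_pos_part`).

Uniqueness. As `β > 1`, `β = 2q - 1`. Formally, test the difference of the equations for `u` and `v`
with `((u - v)⁺) ^ β`. The left side is `β / q²` times the squared `L²` norm of the gradient of `((u
- v)⁺) ^ q`, and the right side is nonpositive because `f ≥ 0` and `s ↦ s ^ (-β)` decreases. Hence
`u ≤ v`, and symmetry gives equality. This test function is not admissible: it need not have compact
support, and near the boundary it is the gradient of `u ^ q`, not of `u`, that is square integrable.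

The remedy (`exists_energy_le`) is to choose `φ ∈ C^∞_c` close to `u ^ q` and to replace `u` by `min
(φ ^ (1 / q)) u`. The positive part of `m = min (φ ^ (1 / q)) u - v` lives in the support of `φ`,
where `u` and `v` are bounded below, so its power `β` may be tested. The price is the error `D = ∇u
- ∇(φ ^ (1 / q))` on the set where `φ ^ (1 / q) ≤ u`. It enters with the weight `q m ^ (q - 1) ≤ q φ
^ (1 - 1 / q)`, and this larger weight turns it into `(φ / u ^ q) ^ (1 - 1 / q) ∇(u ^ q) - ∇φ`,
which tends to `0` in `L²` as `φ → u ^ q` in `H¹₀` and almost everywhere. So the gradient of `(m⁺) ^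
q` tends to `0`. Poincaré's inequality and Fatou's lemma then give `(u - v)⁺ = 0`
(`IsSingularSolution.ae_le`).

The calculus behind this is a chain rule for Lipschitz functions having a right derivative
everywhere (`IsH1LocGradient.comp`), obtained by mollification. -/

open scoped Convolution ContDiff NNReal

/-! ### Convergence in `L²`. -/

section SquareIntegrable

variable {α : Type*} [MeasurableSpace α] {μ : Measure α}
variable {G : Type*} [NormedAddCommGroup G]

theorem sq_eLpNorm_two (f : α → G) : eLpNorm f 2 μ ^ 2 = ∫⁻ x, ‖f x‖ₑ ^ 2 ∂μ := by
  have := eLpNorm_nnreal_pow_eq_lintegral (μ := μ) (f := f) (p := 2) two_ne_zero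
  simpa using this

theorem tendsto_zero_of_tendsto_sq {ι : Type*} {l : Filter ι} {a : ι → ENNReal}
    (h : Tendsto (fun i => a i ^ 2) l (𝓝 0)) : Tendsto a l (𝓝 0) := by
  rw [ENNReal.tendsto_nhds_zero] at h ⊢
  intro ε hε
  filter_upwards [h (ε ^ 2) (by positivity)] with i hi
  exact (ENNReal.pow_le_pow_left_iff two_ne_zero).1 hi

theorem tendsto_eLpNorm_two_of_dominated {f : ℕ → α → G} {b : α → ℝ}
    (hf : ∀ n, AEStronglyMeasurable (f n) μ) (hb : MemLp b 2 μ)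
    (hfb : ∀ n, ∀ᵐ x ∂μ, ‖f n x‖ ≤ b x)
    (hlim : ∀ᵐ x ∂μ, Tendsto (fun n => f n x) atTop (𝓝 0)) :
    Tendsto (fun n => eLpNorm (f n) 2 μ) atTop (𝓝 0) := by
  apply tendsto_zero_of_tendsto_sq
  simp_rw [sq_eLpNorm_two]
  have h0 : ∫⁻ x, ‖(0 : G)‖ₑ ^ 2 ∂μ = 0 := by simp
  rw [← h0]
  refine tendsto_lintegral_of_dominated_convergence' (fun x => ‖b x‖ₑ ^ 2)
    (fun n => (hf n).enorm.pow_const 2) (fun n => ?_) ?_ ?_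
  · filter_upwards [hfb n] with x hx
    gcongr
    exact enorm_le_iff_norm_le.2 (hx.trans (Real.le_norm_self _))
  · rw [← sq_eLpNorm_two]
    exact ENNReal.pow_ne_top hb.2.ne
  · filter_upwards [hlim] with x hx
    exact ((ENNReal.continuous_pow 2).tendsto _).comp ((continuous_enorm.tendsto _).comp hx)

theorem tendsto_eLpNorm_add_zero {f g : ℕ → α → G} (hf : ∀ n, AEStronglyMeasurable (f n) μ)
    (hg : ∀ n, AEStronglyMeasurable (g n) μ)
    (hf0 : Tendsto (fun n => eLpNorm (f n) 2 μ) atTop (𝓝 0))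
    (hg0 : Tendsto (fun n => eLpNorm (g n) 2 μ) atTop (𝓝 0)) :
    Tendsto (fun n => eLpNorm (fun x => f n x + g n x) 2 μ) atTop (𝓝 0) := by
  have h := hf0.add hg0
  rw [add_zero] at h
  exact tendsto_of_tendsto_of_tendsto_of_le_of_le tendsto_const_nhds h (fun _ => zero_le)
    (fun n => eLpNorm_add_le (hf n) (hg n) one_le_two)

theorem exists_subseq_tendsto_ae {f : ℕ → α → G} {g : α → G}
    (hf : ∀ n, AEStronglyMeasurable (f n) μ) (hg : AEStronglyMeasurable g μ)
    (h : Tendsto (fun n => eLpNorm (fun x => f n x - g x) 2 μ) atTop (𝓝 0)) :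
    ∃ ns : ℕ → ℕ, StrictMono ns ∧ ∀ᵐ x ∂μ, Tendsto (fun i => f (ns i) x) atTop (𝓝 (g x)) :=
  (tendstoInMeasure_of_tendsto_eLpNorm two_ne_zero hf hg h).exists_seq_tendsto_ae

/-- Split the difference as `θₙ (γₙ - g) + (θₙ - θ') g`. The first term is at most `C` times a null
sequence, the second is dominated by `2 C ‖g‖`. With `θₙ = h(uₙ)` this is the limit passage in every
chain rule below. -/
theorem tendsto_eLpNorm_smul_sub [NormedSpace ℝ G] {θ : ℕ → α → ℝ} {θ' : α → ℝ}
    {γ : ℕ → α → G} {g : α → G} {C : ℝ}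
    (hθ : ∀ n, AEStronglyMeasurable (θ n) μ) (hθ' : AEStronglyMeasurable θ' μ)
    (hC : ∀ n, ∀ᵐ x ∂μ, |θ n x| ≤ C)
    (hlim : ∀ᵐ x ∂μ, Tendsto (fun n => θ n x) atTop (𝓝 (θ' x)))
    (hγ : ∀ n, AEStronglyMeasurable (γ n) μ) (hg : MemLp g 2 μ)
    (h : Tendsto (fun n => eLpNorm (fun x => γ n x - g x) 2 μ) atTop (𝓝 0)) :
    Tendsto (fun n => eLpNorm (fun x => θ n x • γ n x - θ' x • g x) 2 μ) atTop (𝓝 0) := by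
  have hC' : ∀ᵐ x ∂μ, |θ' x| ≤ C := by
    filter_upwards [hlim, ae_all_iff.2 hC] with x hx hx'
    exact le_of_tendsto hx.abs (Eventually.of_forall hx')
  have h1 : Tendsto (fun n => eLpNorm (fun x => θ n x • (γ n x - g x)) 2 μ) atTop (𝓝 0) := by
    have hb : Tendsto (fun n => ENNReal.ofReal C * eLpNorm (fun x => γ n x - g x) 2 μ)
        atTop (𝓝 0) := by
      simpa using ENNReal.Tendsto.const_mul h (Or.inr ENNReal.ofReal_ne_top)
    refine tendsto_of_tendsto_of_tendsto_of_le_of_le tendsto_const_nhds hb (fun _ => zero_le)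
      (fun n => eLpNorm_le_mul_eLpNorm_of_ae_le_mul ?_ 2)
    filter_upwards [hC n] with x hx
    rw [norm_smul]
    exact mul_le_mul_of_nonneg_right hx (norm_nonneg _)
  have h2 : Tendsto (fun n => eLpNorm (fun x => (θ n x - θ' x) • g x) 2 μ) atTop (𝓝 0) := by
    refine tendsto_eLpNorm_two_of_dominated (b := fun x => (2 * C) * ‖g x‖)
      (fun n => ((hθ n).sub hθ').smul hg.1) (hg.norm.const_mul _) (fun n => ?_) ?_
    · filter_upwards [hC n, hC'] with x hx hx'
      rw [norm_smul]
      refine mul_le_mul_of_nonneg_right ?_ (norm_nonneg _)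
      rw [Real.norm_eq_abs]
      linarith [abs_sub (θ n x) (θ' x)]
    · filter_upwards [hlim] with x hx
      have := (hx.sub_const (θ' x)).smul_const (g x)
      simpa using this
  refine (tendsto_eLpNorm_add_zero (fun n => (hθ n).smul ((hγ n).sub hg.1))
    (fun n => ((hθ n).sub hθ').smul hg.1) h1 h2).congr fun n =>
      congrArg (fun F => eLpNorm F 2 μ) (funext fun x => ?_)
  change θ n x • (γ n x - g x) + (θ n x - θ' x) • g x = _
  rw [smul_sub, sub_smul]
  abel

theorem MeasureTheory.MemLp.bdd_smul [NormedSpace ℝ G] {θ : α → ℝ} {g : α → G} {C : ℝ}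
    (hg : MemLp g 2 μ) (hθ : AEStronglyMeasurable θ μ) (hC : ∀ᵐ x ∂μ, |θ x| ≤ C) :
    MemLp (fun x => θ x • g x) 2 μ := by
  refine hg.of_le_mul (c := C) (hθ.smul hg.1) ?_
  filter_upwards [hC] with x hx
  rw [norm_smul]
  exact mul_le_mul_of_nonneg_right hx (norm_nonneg _)

variable [InnerProductSpace ℝ G]

theorem MeasureTheory.MemLp.integrable_inner_two {a b : α → G} (ha : MemLp a 2 μ)
    (hb : MemLp b 2 μ) : Integrable (fun x => inner ℝ (a x) (b x)) μ := by
  refine (ha.norm.integrable_mul hb.norm).mono (ha.1.inner hb.1) (Eventually.of_forall fun x => ?_)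
  refine (norm_inner_le_norm (𝕜 := ℝ) (a x) (b x)).trans ?_
  simp

theorem tendsto_integral_inner {a : ℕ → α → G} {a' b : α → G}
    (ha : ∀ n, MemLp (a n) 2 μ) (ha' : MemLp a' 2 μ) (hb : MemLp b 2 μ)
    (h : Tendsto (fun n => eLpNorm (fun x => a n x - a' x) 2 μ) atTop (𝓝 0)) :
    Tendsto (fun n => ∫ x, inner ℝ (b x) (a n x) ∂μ) atTop (𝓝 (∫ x, inner ℝ (b x) (a' x) ∂μ)) := by

  refine tendsto_integral_of_L1' _ (hb.1.inner ha'.1)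
    (Eventually.of_forall fun n => hb.integrable_inner_two (ha n)) ?_
  have hb' : Tendsto (fun n => eLpNorm b 2 μ * eLpNorm (fun x => a n x - a' x) 2 μ)
      atTop (𝓝 0) := by
    simpa using ENNReal.Tendsto.const_mul h (Or.inr hb.2.ne)
  refine tendsto_of_tendsto_of_tendsto_of_le_of_le tendsto_const_nhds hb' (fun _ => zero_le)
    (fun n => ?_)
  have := eLpNorm_le_eLpNorm_mul_eLpNorm'_of_norm (p := 2) (q := 2) (r := 1) hb.1
    ((ha n).1.sub ha'.1) (fun u v => inner ℝ u v) 1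
    (Eventually.of_forall fun x => by simpa using norm_inner_le_norm (𝕜 := ℝ) (b x) _)
  rw [ENNReal.coe_one, one_mul] at this
  refine le_trans (le_of_eq ?_) this
  congr 1
  ext x
  simp [inner_sub_right]

end SquareIntegrable

/-! ### Mollification. -/

section Mollify

variable {N : ℕ} {G : Type*} [NormedAddCommGroup G] [NormedSpace ℝ G]

/-- A bump function on the ball of radius `1 / (n + 1)` around the origin. -/
noncomputable def mollifierBump (N n : ℕ) : ContDiffBump (0 : EuclideanSpace ℝ (Fin N)) where
  rIn := 1 / (2 * ((n : ℝ) + 1))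
  rOut := 1 / ((n : ℝ) + 1)
  rIn_pos := by positivity
  rIn_lt_rOut := by
    have : (0 : ℝ) < (n : ℝ) + 1 := by positivity
    exact one_div_lt_one_div_of_lt this (by linarith)

/-- The convolution kernel at scale `1 / (n + 1)`. -/
noncomputable def mollifier (N n : ℕ) : EuclideanSpace ℝ (Fin N) → ℝ :=
  (mollifierBump N n).normed volume

/-- The mollification of `g` at scale `1 / (n + 1)`. -/
noncomputable def mollify (n : ℕ) (g : EuclideanSpace ℝ (Fin N) → G) :
    EuclideanSpace ℝ (Fin N) → G :=
  mollifier N n ⋆[ContinuousLinearMap.lsmul ℝ ℝ, volume] g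

theorem mollifier_nonneg (n : ℕ) (x : EuclideanSpace ℝ (Fin N)) : 0 ≤ mollifier N n x :=
  (mollifierBump N n).nonneg_normed x

theorem integral_mollifier (n : ℕ) : ∫ x, mollifier N n x = 1 :=
  (mollifierBump N n).integral_normed

theorem contDiff_mollifier (n : ℕ) : ContDiff ℝ ∞ (mollifier N n) :=
  (mollifierBump N n).contDiff_normed

theorem hasCompactSupport_mollifier (n : ℕ) : HasCompactSupport (mollifier N n) :=
  (mollifierBump N n).hasCompactSupport_normed

theorem mollifier_eq_zero {n : ℕ} {x : EuclideanSpace ℝ (Fin N)} (hx : 1 / ((n : ℝ) + 1) ≤ ‖x‖) :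
    mollifier N n x = 0 := by
  by_contra h
  have : x ∈ Function.support (mollifier N n) := h
  rw [mollifier, ContDiffBump.support_normed_eq, mem_ball_zero_iff] at this
  exact absurd this (not_lt.2 hx)

theorem integrable_mollifier (n : ℕ) : Integrable (mollifier N n) :=
  (contDiff_mollifier n).continuous.integrable_of_hasCompactSupport (hasCompactSupport_mollifier n)

theorem contDiff_mollify (n : ℕ) {g : EuclideanSpace ℝ (Fin N) → G} (hg : LocallyIntegrable g) :
    ContDiff ℝ ∞ (mollify n g) :=
  (hasCompactSupport_mollifier n).contDiff_convolution_left (n := ⊤) _ (contDiff_mollifier n) hg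

theorem mollify_apply (n : ℕ) (g : EuclideanSpace ℝ (Fin N) → G) (x : EuclideanSpace ℝ (Fin N)) :
    mollify n g x = ∫ t, mollifier N n t • g (x - t) := rfl

/-- The probability measure whose density is the convolution kernel. -/
noncomputable def mollifierMeasure (N n : ℕ) : Measure (EuclideanSpace ℝ (Fin N)) :=
  volume.withDensity fun x => ENNReal.ofReal (mollifier N n x)

instance (n : ℕ) : IsProbabilityMeasure (mollifierMeasure N n) := by
  constructor
  rw [mollifierMeasure, withDensity_apply _ MeasurableSet.univ, Measure.restrict_univ,
    ← ofReal_integral_eq_lintegral_ofReal (integrable_mollifier n)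
      (Eventually.of_forall (mollifier_nonneg n)), integral_mollifier, ENNReal.ofReal_one]

theorem mollify_eq_integral (n : ℕ) (g : EuclideanSpace ℝ (Fin N) → G)
    (x : EuclideanSpace ℝ (Fin N)) : mollify n g x = ∫ t, g (x - t) ∂(mollifierMeasure N n) := by
  rw [mollifierMeasure, integral_withDensity_eq_integral_toReal_smul
    (contDiff_mollifier n).continuous.measurable.ennreal_ofReal
    (Eventually.of_forall fun _ => ENNReal.ofReal_lt_top), mollify_apply]
  simp_rw [ENNReal.toReal_ofReal (mollifier_nonneg n _)]

theorem norm_mollify_le (n : ℕ) {g : EuclideanSpace ℝ (Fin N) → G} {M : ℝ}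
    (hM : ∀ x, ‖g x‖ ≤ M) (x : EuclideanSpace ℝ (Fin N)) : ‖mollify n g x‖ ≤ M := by
  rw [mollify_eq_integral]
  refine (norm_integral_le_of_norm_le_const (C := M) (Eventually.of_forall fun t => hM _)).trans ?_
  simp

theorem mollify_eq_zero (n : ℕ) {g : EuclideanSpace ℝ (Fin N) → G} {x : EuclideanSpace ℝ (Fin N)}
    (h : ∀ y, dist x y < 1 / ((n : ℝ) + 1) → g y = 0) : mollify n g x = 0 := by
  rw [mollify_apply]
  apply integral_eq_zero_of_ae
  refine Eventually.of_forall fun t => ?_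
  by_cases ht : 1 / ((n : ℝ) + 1) ≤ ‖t‖
  · simp [mollifier_eq_zero ht]
  · have := h (x - t) (by simpa [dist_eq_norm] using ht)
    simp [this]

theorem mollify_congr (n : ℕ) {g g' : EuclideanSpace ℝ (Fin N) → G} (h : g =ᵐ[volume] g') :
    mollify n g = mollify n g' := by
  unfold mollify
  exact convolution_congr _ (ae_eq_refl _) h

/-- A mollification is an average against a probability measure, so the square of the average is at
most the average of the square. Tonelli and translation invariance finish the estimate. -/
theorem eLpNorm_mollify_le (n : ℕ) {g : EuclideanSpace ℝ (Fin N) → G}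
    (hg : AEStronglyMeasurable g) : eLpNorm (mollify n g) 2 ≤ eLpNorm g 2 := by
  -- A strongly measurable representative makes `(x, t) ↦ g' (x - t)` jointly measurable, as Tonelli
  -- requires.
  rw [mollify_congr n hg.ae_eq_mk, eLpNorm_congr_ae hg.ae_eq_mk]
  have hm := hg.stronglyMeasurable_mk
  generalize hg.mk g = g' at hm
  rw [← ENNReal.pow_le_pow_left_iff two_ne_zero, sq_eLpNorm_two, sq_eLpNorm_two]
  calc ∫⁻ x, ‖mollify n g' x‖ₑ ^ 2
      ≤ ∫⁻ x, ∫⁻ t, ‖g' (x - t)‖ₑ ^ 2 ∂(mollifierMeasure N n) := by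
        refine lintegral_mono fun x => ?_
        rw [mollify_eq_integral, ← sq_eLpNorm_two (fun t => g' (x - t))]
        gcongr
        refine (enorm_integral_le_lintegral_enorm _).trans ?_
        rw [← eLpNorm_one_eq_lintegral_enorm]
        exact eLpNorm_le_eLpNorm_of_exponent_le one_le_two
          (hm.comp_measurable (measurable_const.sub measurable_id)).aestronglyMeasurable
    _ = ∫⁻ t, (∫⁻ x, ‖g' (x - t)‖ₑ ^ 2) ∂(mollifierMeasure N n) := by
        refine lintegral_lintegral_swap (μ := volume) (ν := mollifierMeasure N n)
          (f := fun x t => ‖g' (x - t)‖ₑ ^ 2) (Measurable.aemeasurable ?_)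
        exact (hm.comp_measurable (measurable_fst.sub measurable_snd)).enorm.pow_const 2
    _ = ∫⁻ x, ‖g' x‖ₑ ^ 2 := by
        simp_rw [fun t => lintegral_sub_right_eq_self (μ := volume) (fun x => ‖g' x‖ₑ ^ 2) t]
        simp

theorem ae_tendsto_mollify [CompleteSpace G] {g : EuclideanSpace ℝ (Fin N) → G}
    (hg : LocallyIntegrable g) :
    ∀ᵐ x, Tendsto (fun n => mollify n g x) atTop (𝓝 (g x)) := by
  -- The outer radius is exactly twice the inner one; such a bounded ratio is what Lebesgue
  -- differentiation needs.
  refine ContDiffBump.ae_convolution_tendsto_right_of_locallyIntegrable (K := 2)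
    tendsto_one_div_add_atTop_nhds_zero_nat (Eventually.of_forall fun n => le_of_eq ?_) hg
  change 1 / ((n : ℝ) + 1) = 2 * (1 / (2 * ((n : ℝ) + 1)))
  field_simp

theorem mollify_sub (n : ℕ) {f g : EuclideanSpace ℝ (Fin N) → G} (hf : LocallyIntegrable f)
    (hg : LocallyIntegrable g) (x : EuclideanSpace ℝ (Fin N)) :
    mollify n (f - g) x = mollify n f x - mollify n g x := by
  have hc := (contDiff_mollifier (N := N) n).continuous
  have h := hasCompactSupport_mollifier (N := N) n
  have h1 : Integrable (fun t => mollifier N n t • f (x - t)) :=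
    h.convolutionExists_left (ContinuousLinearMap.lsmul ℝ ℝ) hc hf x
  have h2 : Integrable (fun t => mollifier N n t • g (x - t)) :=
    h.convolutionExists_left (ContinuousLinearMap.lsmul ℝ ℝ) hc hg x
  simp_rw [mollify_apply]
  rw [← integral_sub h1 h2]
  simp [smul_sub]

theorem tendsto_eLpNorm_mollify_of_continuous [CompleteSpace G] {g : EuclideanSpace ℝ (Fin N) → G}
    (hc : Continuous g) (hs : HasCompactSupport g) :
    Tendsto (fun n => eLpNorm (fun x => mollify n g x - g x) 2) atTop (𝓝 0) := by
  obtain ⟨M, hM⟩ := hc.bounded_above_of_compact_support hs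
  have hM0 : 0 ≤ M := (norm_nonneg _).trans (hM 0)
  -- All mollification radii are at most `1`, so this single compact set carries every difference.
  set K := Metric.cthickening 1 (tsupport g) with hK
  have hKc : IsCompact K := hs.isCompact.cthickening
  have hli : LocallyIntegrable g := hc.locallyIntegrable
  refine tendsto_eLpNorm_two_of_dominated (b := K.indicator fun _ => 2 * M)
    (fun n => ((contDiff_mollify n hli).continuous.sub hc).aestronglyMeasurable) ?_
    (fun n => Eventually.of_forall fun x => ?_) ?_
  · rw [memLp_indicator_iff_restrict hKc.measurableSet]
    have : IsFiniteMeasure (volume.restrict K) := ⟨by simpa using hKc.measure_lt_top⟩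
    exact memLp_const _
  · by_cases hx : x ∈ K
    · rw [Set.indicator_of_mem hx]
      refine (norm_sub_le _ _).trans ?_
      linarith [norm_mollify_le n hM x, hM x]
    · have h0 : g x = 0 := image_eq_zero_of_notMem_tsupport
        fun h => hx (Metric.self_subset_cthickening _ h)
      have h1 : mollify n g x = 0 := mollify_eq_zero n fun y hy => by
        refine image_eq_zero_of_notMem_tsupport fun h => hx ?_
        refine Metric.mem_cthickening_of_dist_le x y 1 _ h (hy.le.trans ?_)
        rw [div_le_one (by positivity)]
        linarith [(Nat.cast_nonneg n : (0 : ℝ) ≤ n)]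
      rw [Set.indicator_of_notMem hx, h0, h1]
      simp
  · filter_upwards [ae_tendsto_mollify hli] with x hx
    simpa using hx.sub_const (g x)

/-- Approximate `g` by a continuous compactly supported `c`; mollification does not increase the
`L²` norm, so the errors on both sides of `c` stay small. -/
theorem tendsto_eLpNorm_mollify [CompleteSpace G] {g : EuclideanSpace ℝ (Fin N) → G}
    (hg : MemLp g 2) :
    Tendsto (fun n => eLpNorm (fun x => mollify n g x - g x) 2) atTop (𝓝 0) := by
  rw [ENNReal.tendsto_nhds_zero]
  intro ε hε
  have hε3 : ε / 3 ≠ 0 := by simpa using hε.ne'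
  obtain ⟨c, hcs, hgc, hcc, hc2⟩ :=
    hg.exists_hasCompactSupport_eLpNorm_sub_le ENNReal.ofNat_ne_top hε3
  have hgl := hg.locallyIntegrable one_le_two
  have hcl := hc2.locallyIntegrable one_le_two
  filter_upwards [ENNReal.tendsto_nhds_zero.1 (tendsto_eLpNorm_mollify_of_continuous hcc hcs)
    (ε / 3) (pos_iff_ne_zero.2 hε3)] with n hn
  have hsub : LocallyIntegrable (g - c) := hgl.sub hcl
  have e : (fun x => mollify n g x - g x) =
      (mollify n (g - c) + fun x => mollify n c x - c x) - (g - c) := by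
    ext x
    simp only [Pi.sub_apply, Pi.add_apply, mollify_sub n hgl hcl]
    abel
  rw [e]
  have m1 : AEStronglyMeasurable (mollify n (g - c)) :=
    (contDiff_mollify n hsub).continuous.aestronglyMeasurable
  have m2 : AEStronglyMeasurable (fun x => mollify n c x - c x) :=
    ((contDiff_mollify n hcl).continuous.sub hcc).aestronglyMeasurable
  have m3 : AEStronglyMeasurable (g - c) := hg.1.sub hc2.1
  calc _ ≤ eLpNorm (mollify n (g - c)) 2 + eLpNorm (fun x => mollify n c x - c x) 2
        + eLpNorm (g - c) 2 :=
        (eLpNorm_sub_le (m1.add m2) m3 one_le_two).trans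
          (by gcongr; exact eLpNorm_add_le m1 m2 one_le_two)
    _ ≤ ε / 3 + ε / 3 + ε / 3 := by
        gcongr
        exact (eLpNorm_mollify_le n m3).trans hgc
    _ = ε := ENNReal.add_thirds ε

end Mollify

/-! ### Weak gradients and their mollification. -/

section WeakGradient

variable {N : ℕ} {Ω : Opens (EuclideanSpace ℝ (Fin N))}

/-- `g` is the weak gradient of `u` in `Ω`, and `u` and `g` are square integrable on compact
subsets of `Ω`. -/
structure IsH1LocGradient (Ω : Opens (EuclideanSpace ℝ (Fin N)))
    (u : EuclideanSpace ℝ (Fin N) → ℝ)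
    (g : EuclideanSpace ℝ (Fin N) → EuclideanSpace ℝ (Fin N)) : Prop where
  isWeakGradient : IsWeakGradient Ω u g
  memLp_fun : ∀ K : Set (EuclideanSpace ℝ (Fin N)), IsCompact K → K ⊆ Ω →
    MemLp u 2 (volume.restrict K)
  memLp_grad : ∀ K : Set (EuclideanSpace ℝ (Fin N)), IsCompact K → K ⊆ Ω →
    MemLp g 2 (volume.restrict K)

theorem memLp_two_integrableOn {G : Type*} [NormedAddCommGroup G]
    {u : EuclideanSpace ℝ (Fin N) → G} {K : Set (EuclideanSpace ℝ (Fin N))} (hK : IsCompact K)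
    (hu : MemLp u 2 (volume.restrict K)) : IntegrableOn u K := by
  have : IsFiniteMeasure (volume.restrict K) := ⟨by simpa using hK.measure_lt_top⟩
  exact hu.integrable one_le_two

theorem locallyIntegrableOn_of_memLp_two {G : Type*} [NormedAddCommGroup G]
    {u : EuclideanSpace ℝ (Fin N) → G}
    (hu : ∀ K : Set (EuclideanSpace ℝ (Fin N)), IsCompact K → K ⊆ Ω →
      MemLp u 2 (volume.restrict K)) : LocallyIntegrableOn u Ω :=
  (locallyIntegrableOn_iff Ω.isOpen.isLocallyClosed).2 fun K hKs hK =>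
    memLp_two_integrableOn hK (hu K hK hKs)

theorem Continuous.memLp_restrict_isCompact {G : Type*} [NormedAddCommGroup G]
    {u : EuclideanSpace ℝ (Fin N) → G} (hu : Continuous u)
    {K : Set (EuclideanSpace ℝ (Fin N))} (hK : IsCompact K) : MemLp u 2 (volume.restrict K) := by
  have : IsFiniteMeasure (volume.restrict K) := ⟨by simpa using hK.measure_lt_top⟩
  obtain ⟨C, hC⟩ := hK.exists_bound_of_continuousOn hu.continuousOn
  exact MemLp.of_bound hu.aestronglyMeasurable C
    ((ae_restrict_iff' hK.measurableSet).2 (Eventually.of_forall hC))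

theorem gradient_apply (φ : EuclideanSpace ℝ (Fin N) → ℝ) (x : EuclideanSpace ℝ (Fin N))
    (i : Fin N) : (gradient φ x) i = fderiv ℝ φ x (EuclideanSpace.single i 1) := by
  rw [← inner_gradient_left, EuclideanSpace.inner_single_right]
  simp

theorem ContDiff.continuous_gradient {φ : EuclideanSpace ℝ (Fin N) → ℝ} (hφ : ContDiff ℝ 1 φ) :
    Continuous (gradient φ) := by
  unfold gradient
  exact (LinearIsometryEquiv.continuous _).comp (hφ.continuous_fderiv one_ne_zero)

theorem gradient_eq_zero_of_notMem_tsupport {φ : EuclideanSpace ℝ (Fin N) → ℝ}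
    {x : EuclideanSpace ℝ (Fin N)} (hx : x ∉ tsupport φ) : gradient φ x = 0 := by
  rw [gradient, fderiv_of_notMem_tsupport ℝ hx, map_zero]

theorem TestFunction.contDiff_one (φ : TestFunction Ω ℝ ⊤) : ContDiff ℝ 1 φ :=
  φ.contDiff.of_le (by exact_mod_cast le_top)

theorem setIntegral_eq_of_subset_opens {F : EuclideanSpace ℝ (Fin N) → ℝ}
    {K : Set (EuclideanSpace ℝ (Fin N))} (hKΩ : K ⊆ Ω)
    (hF : ∀ x, x ∉ K → F x = 0) :
    ∫ x in (Ω : Set (EuclideanSpace ℝ (Fin N))), F x = ∫ x in K, F x :=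
  setIntegral_eq_of_subset_of_forall_sdiff_eq_zero Ω.isOpen.measurableSet hKΩ
    fun x hx => hF x hx.2

/-- The fundamental lemma of the calculus of variations, applied to each coordinate. It identifies
the gradients provided by separate existential statements. -/
theorem IsWeakGradient.ae_eq {u : EuclideanSpace ℝ (Fin N) → ℝ}
    {g g' : EuclideanSpace ℝ (Fin N) → EuclideanSpace ℝ (Fin N)} (h : IsWeakGradient Ω u g)
    (h' : IsWeakGradient Ω u g') :
    g =ᵐ[volume.restrict (Ω : Set (EuclideanSpace ℝ (Fin N)))] g' := by
  have key : ∀ i : Fin N, ∀ᵐ x, x ∈ (Ω : Set (EuclideanSpace ℝ (Fin N))) → g x i - g' x i = 0 := by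
    intro i
    have hi : ∀ {γ : EuclideanSpace ℝ (Fin N) → EuclideanSpace ℝ (Fin N)},
        LocallyIntegrableOn γ Ω → LocallyIntegrableOn (fun x => γ x i) Ω := fun hγ => by
      rw [locallyIntegrableOn_iff Ω.isOpen.isLocallyClosed] at hγ ⊢
      exact fun K hKs hK =>
        (EuclideanSpace.proj (𝕜 := ℝ) i).integrable_comp (hγ K hKs hK)
    refine Ω.isOpen.ae_eq_zero_of_integral_contDiff_smul_eq_zero
      ((hi h.locallyIntegrableOn_grad).sub (hi h'.locallyIntegrableOn_grad)) ?_
    intro φ hφ hφc hφs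
    let Φ : TestFunction Ω ℝ ⊤ := ⟨φ, hφ, hφc, hφs⟩
    have e1 := h.integral_eq Φ i
    have e2 := h'.integral_eq Φ i
    have hint : ∀ {γ : EuclideanSpace ℝ (Fin N) → EuclideanSpace ℝ (Fin N)},
        LocallyIntegrableOn γ Ω → IntegrableOn (fun x => γ x i * φ x) (tsupport φ) := fun hγ =>
      ((locallyIntegrableOn_iff Ω.isOpen.isLocallyClosed).1 (hi hγ) _ hφs hφc).mul_continuousOn
        hφ.continuous.continuousOn hφc
    have hz : ∀ γ : EuclideanSpace ℝ (Fin N) → EuclideanSpace ℝ (Fin N), ∀ x, x ∉ tsupport φ →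
        γ x i * φ x = 0 := fun γ x hx => by simp [image_eq_zero_of_notMem_tsupport hx]
    have e3 : ∫ x in (Ω : Set (EuclideanSpace ℝ (Fin N))), g x i * φ x =
      ∫ x in (Ω : Set (EuclideanSpace ℝ (Fin N))), g' x i * φ x :=
      neg_injective (e1.symm.trans e2)
    rw [setIntegral_eq_of_subset_opens hφs (hz g),
      setIntegral_eq_of_subset_opens hφs (hz g')] at e3
    have e4 : ∫ x, φ x • (g x i - g' x i) = ∫ x in tsupport φ, (g x i * φ x - g' x i * φ x) := by
      rw [setIntegral_eq_integral_of_forall_compl_eq_zero]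
      · simp only [smul_eq_mul]
        congr 1
        ext x
        ring
      · intro x hx
        rw [hz g x hx, hz g' x hx, sub_zero]
    change ∫ x, φ x • (g x i - g' x i) = 0
    rw [e4, integral_sub (hint h.locallyIntegrableOn_grad) (hint h'.locallyIntegrableOn_grad), e3,
      sub_self]
  filter_upwards [(ae_restrict_iff' Ω.isOpen.measurableSet).2 (ae_all_iff.2 key |>.mono
    fun x hx hxΩ i => hx i hxΩ)] with x hx
  ext i
  exact sub_eq_zero.1 (hx i)

theorem integral_mul_gradient_of_contDiff {w : EuclideanSpace ℝ (Fin N) → ℝ}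
    (hw : ContDiff ℝ 1 w) (φ : TestFunction Ω ℝ ⊤) (i : Fin N) :
    ∫ x in (Ω : Set (EuclideanSpace ℝ (Fin N))), w x * (gradient φ x) i =
      -∫ x in (Ω : Set (EuclideanSpace ℝ (Fin N))), (gradient w x) i * φ x := by
  have hz : ∀ x, x ∉ (Ω : Set (EuclideanSpace ℝ (Fin N))) → x ∉ tsupport φ :=
    fun x hx h => hx (φ.tsupport_subset h)
  rw [setIntegral_eq_integral_of_forall_compl_eq_zero,
    setIntegral_eq_integral_of_forall_compl_eq_zero]
  · simp_rw [gradient_apply]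
    have hc := φ.contDiff_one
    have hwf : Continuous fun x => fderiv ℝ w x (EuclideanSpace.single i 1) :=
      (hw.continuous_fderiv one_ne_zero).clm_apply continuous_const
    have hφf : Continuous fun x => fderiv ℝ φ x (EuclideanSpace.single i 1) :=
      (hc.continuous_fderiv one_ne_zero).clm_apply continuous_const
    refine integral_mul_fderiv_eq_neg_fderiv_mul_of_integrable ?_ ?_ ?_
      (fun x _ => hw.differentiable one_ne_zero x) (fun x _ => hc.differentiable one_ne_zero x)
    · exact (hwf.mul φ.continuous).integrable_of_hasCompactSupport φ.hasCompactSupport.mul_left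
    · exact (hw.continuous.mul hφf).integrable_of_hasCompactSupport
        (φ.hasCompactSupport.fderiv_apply ℝ _).mul_left
    · exact (hw.continuous.mul φ.continuous).integrable_of_hasCompactSupport
        φ.hasCompactSupport.mul_left
  · intro x hx
    simp [image_eq_zero_of_notMem_tsupport (hz x hx)]
  · intro x hx
    simp [gradient_eq_zero_of_notMem_tsupport (hz x hx)]

/-- For fixed `x` the kernel `t ↦ mollifier N n (x - t)` is itself a test function in `Ω`, and the
weak gradient identity is applied to it. Cutting off outside `K` makes the convolution global; it
has no effect at `x`, since the kernel is supported in a ball contained in `K`. -/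
theorem gradient_mollify {u : EuclideanSpace ℝ (Fin N) → ℝ}
    {g : EuclideanSpace ℝ (Fin N) → EuclideanSpace ℝ (Fin N)} (h : IsWeakGradient Ω u g)
    {K : Set (EuclideanSpace ℝ (Fin N))} (hK : IsCompact K) (hKΩ : K ⊆ Ω) (n : ℕ)
    {x : EuclideanSpace ℝ (Fin N)} (hx : Metric.closedBall x (1 / ((n : ℝ) + 1)) ⊆ K) :
    gradient (mollify n (K.indicator u)) x = mollify n (K.indicator g) x := by
  have hu : LocallyIntegrable (K.indicator u) :=
    ((integrable_indicator_iff hK.measurableSet).2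
      (h.locallyIntegrableOn_fun.integrableOn_compact_subset hKΩ hK)).locallyIntegrable
  have hg : LocallyIntegrable (K.indicator g) :=
    ((integrable_indicator_iff hK.measurableSet).2
      (h.locallyIntegrableOn_grad.integrableOn_compact_subset hKΩ hK)).locallyIntegrable
  have hρ : ContDiff ℝ 1 (mollifier N n) := (contDiff_mollifier n).of_le (by exact_mod_cast le_top)
  have hρs := hasCompactSupport_mollifier (N := N) n
  have hsupp : ∀ t, t ∉ Metric.closedBall x (1 / ((n : ℝ) + 1)) → mollifier N n (x - t) = 0 := by
    intro t ht
    refine mollifier_eq_zero ?_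
    rw [← dist_eq_norm, dist_comm]
    exact (not_le.1 ht).le
  have htsupp : tsupport (fun t => mollifier N n (x - t)) ⊆
      Metric.closedBall x (1 / ((n : ℝ) + 1)) :=
    closure_minimal (fun t ht => by_contra fun h' => ht (hsupp t h')) Metric.isClosed_closedBall
  let ψ : TestFunction Ω ℝ ⊤ := ⟨fun t => mollifier N n (x - t),
    (contDiff_mollifier n).comp (contDiff_const.sub contDiff_id),
    (isCompact_closedBall _ _).of_isClosed_subset (isClosed_tsupport _) htsupp,
    (htsupp.trans hx).trans hKΩ⟩
  have hψ : ∀ t, ψ t = mollifier N n (x - t) := fun t => rfl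
  have hψK : ∀ t, t ∉ K → t ∉ tsupport ψ := fun t ht h' => ht (hx (htsupp h'))
  ext i
  have hgrad : ∀ t, (gradient ψ t) i =
      - fderiv ℝ (mollifier N n) (x - t) (EuclideanSpace.single i 1) := by
    intro t
    rw [gradient_apply]
    have h1 : HasFDerivAt (mollifier N n) (fderiv ℝ (mollifier N n) (x - t)) (x - t) :=
      (hρ.differentiable one_ne_zero _).hasFDerivAt
    have h2 : HasFDerivAt (fun t => x - t)
        (-ContinuousLinearMap.id ℝ (EuclideanSpace ℝ (Fin N))) t :=
      (hasFDerivAt_id t).const_sub x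
    have h3 : HasFDerivAt (ψ : EuclideanSpace ℝ (Fin N) → ℝ) _ t := h1.comp t h2
    rw [h3.fderiv]
    simp
  have key := h.integral_eq ψ i
  have L1 : (gradient (mollify n (K.indicator u)) x) i =
      ∫ t, K.indicator u t * fderiv ℝ (mollifier N n) (x - t) (EuclideanSpace.single i 1) := by
    rw [gradient_apply]
    have h1 := hρs.hasFDerivAt_convolution_right
      (ContinuousLinearMap.lsmul ℝ ℝ : ℝ →L[ℝ] ℝ →L[ℝ] ℝ).flip hu hρ x
    rw [convolution_flip] at h1
    rw [mollify, h1.fderiv, convolution_precompR_apply _ hu (hρs.fderiv ℝ)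
      (hρ.continuous_fderiv one_ne_zero)]
    simp [convolution_def, mul_comm]
  have L2 : (mollify n (K.indicator g) x) i = ∫ t, mollifier N n (x - t) * K.indicator g t i := by
    have e : mollify n (K.indicator g) x = ∫ t, mollifier N n (x - t) • K.indicator g t := by
      rw [mollify, convolution_eq_swap]
      simp
    have hint : Integrable fun t => mollifier N n (x - t) • K.indicator g t := by
      have := (hρs.convolutionExists_left (ContinuousLinearMap.lsmul ℝ ℝ) hρ.continuous hg x)
      simpa using this.integrable_swap
    rw [e]
    have := (EuclideanSpace.proj (𝕜 := ℝ) i).integral_comp_comm hint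
    simpa using this.symm
  rw [L1, L2]
  have z1 : ∀ t, t ∉ (Ω : Set (EuclideanSpace ℝ (Fin N))) → K.indicator u t *
      fderiv ℝ (mollifier N n) (x - t) (EuclideanSpace.single i 1) = 0 := fun t ht => by
    simp [Set.indicator_of_notMem (fun h' => ht (hKΩ h') : t ∉ K)]
  have z2 : ∀ t, t ∉ (Ω : Set (EuclideanSpace ℝ (Fin N))) →
      mollifier N n (x - t) * K.indicator g t i = 0 := fun t ht => by
    simp [Set.indicator_of_notMem (fun h' => ht (hKΩ h') : t ∉ K)]
  rw [← setIntegral_eq_integral_of_forall_compl_eq_zero (μ := volume) z1,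
    ← setIntegral_eq_integral_of_forall_compl_eq_zero (μ := volume) z2]
  rw [← neg_inj]
  have e1 : ∀ t, u t * (gradient ψ t) i =
      -(K.indicator u t * fderiv ℝ (mollifier N n) (x - t) (EuclideanSpace.single i 1)) := by
    intro t
    by_cases ht : t ∈ K
    · rw [Set.indicator_of_mem ht, hgrad]
      ring
    · rw [Set.indicator_of_notMem ht, gradient_eq_zero_of_notMem_tsupport (hψK t ht)]
      simp
  have e2 : ∀ t, g t i * ψ t = mollifier N n (x - t) * K.indicator g t i := by
    intro t
    by_cases ht : t ∈ K
    · rw [Set.indicator_of_mem ht, hψ, mul_comm]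
    · rw [Set.indicator_of_notMem ht, image_eq_zero_of_notMem_tsupport (hψK t ht)]
      simp
  simp_rw [e1, e2] at key
  rw [← integral_neg, key]

end WeakGradient

/-! ### The chain rule in `H¹_loc`. -/

section ChainRule

variable {N : ℕ} {Ω : Opens (EuclideanSpace ℝ (Fin N))} {u v : EuclideanSpace ℝ (Fin N) → ℝ}
  {g γ : EuclideanSpace ℝ (Fin N) → EuclideanSpace ℝ (Fin N)}

theorem IsH1LocGradient.exists_mollify_tendsto (H : IsH1LocGradient Ω u g)
    {K : Set (EuclideanSpace ℝ (Fin N))} (hK : IsCompact K) (hKΩ : K ⊆ Ω) :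
    ∃ K' : Set (EuclideanSpace ℝ (Fin N)), LocallyIntegrable (K'.indicator u) ∧
      Tendsto (fun n => eLpNorm (fun x => mollify n (K'.indicator u) x - u x) 2
        (volume.restrict K)) atTop (𝓝 0) ∧
      Tendsto (fun n => eLpNorm (fun x => gradient (mollify n (K'.indicator u)) x - g x) 2
        (volume.restrict K)) atTop (𝓝 0) ∧
      ∀ᵐ x ∂(volume.restrict K),
        Tendsto (fun n => mollify n (K'.indicator u) x) atTop (𝓝 (u x)) := by
  -- Cutting off on a `δ`-neighbourhood of `K` leaves room: once the radius is at most `δ`, the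
  -- mollification near `K` does not see the cutoff.
  obtain ⟨δ, hδ, hδΩ⟩ := hK.exists_cthickening_subset_open Ω.isOpen hKΩ
  set K' := Metric.cthickening δ K with hK'
  have hK'c : IsCompact K' := hK.cthickening
  have hKK' : K ⊆ K' := Metric.self_subset_cthickening _
  have hu : MemLp (K'.indicator u) 2 :=
    (memLp_indicator_iff_restrict hK'c.measurableSet).2 (H.memLp_fun K' hK'c hδΩ)
  have hg : MemLp (K'.indicator g) 2 :=
    (memLp_indicator_iff_restrict hK'c.measurableSet).2 (H.memLp_grad K' hK'c hδΩ)
  have hul := hu.locallyIntegrable one_le_two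
  have mono : ∀ {G : Type} [NormedAddCommGroup G] [NormedSpace ℝ G] [CompleteSpace G]
      {f : EuclideanSpace ℝ (Fin N) → G}, MemLp (K'.indicator f) 2 →
      Tendsto (fun n => eLpNorm (fun x => mollify n (K'.indicator f) x - f x) 2
        (volume.restrict K)) atTop (𝓝 0) := by
    intro G _ _ _ f hf
    refine tendsto_of_tendsto_of_tendsto_of_le_of_le tendsto_const_nhds
      (tendsto_eLpNorm_mollify hf) (fun _ => zero_le) (fun n => ?_)
    refine le_trans (le_of_eq (eLpNorm_congr_ae ?_))
      (eLpNorm_mono_measure _ Measure.restrict_le_self)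
    filter_upwards [ae_restrict_mem hK.measurableSet] with x hx
    rw [Set.indicator_of_mem (hKK' hx)]
  refine ⟨K', hul, mono hu, ?_, ?_⟩
  · have hev : ∀ᶠ n : ℕ in atTop, 1 / ((n : ℝ) + 1) ≤ δ :=
      tendsto_one_div_add_atTop_nhds_zero_nat.eventually (ge_mem_nhds hδ)
    refine (mono hg).congr' ?_
    filter_upwards [hev] with n hn
    refine eLpNorm_congr_ae ?_
    filter_upwards [ae_restrict_mem hK.measurableSet] with x hx
    rw [gradient_mollify H.isWeakGradient hK'c hδΩ n]
    exact (Metric.closedBall_subset_closedBall hn).trans (Metric.closedBall_subset_cthickening hx δ)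
  · filter_upwards [ae_restrict_of_ae (ae_tendsto_mollify hul), ae_restrict_mem hK.measurableSet]
      with x hx hxK
    rwa [Set.indicator_of_mem (hKK' hxK)] at hx

theorem tendsto_integral_mul_gradient {K : Set (EuclideanSpace ℝ (Fin N))} (hK : IsCompact K)
    {w : ℕ → EuclideanSpace ℝ (Fin N) → ℝ} (hw : ∀ n, MemLp (w n) 2 (volume.restrict K))
    (hu : MemLp u 2 (volume.restrict K))
    (h : Tendsto (fun n => eLpNorm (fun x => w n x - u x) 2 (volume.restrict K)) atTop (𝓝 0))
    (φ : TestFunction Ω ℝ ⊤) (hφ : tsupport φ = K) (i : Fin N) :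
    Tendsto (fun n => ∫ x in (Ω : Set (EuclideanSpace ℝ (Fin N))), w n x * (gradient φ x) i) atTop
      (𝓝 (∫ x in (Ω : Set (EuclideanSpace ℝ (Fin N))), u x * (gradient φ x) i)) := by
  have hc : Continuous fun x => (gradient φ x) i :=
    (EuclideanSpace.proj (𝕜 := ℝ) i).continuous.comp φ.contDiff_one.continuous_gradient
  have e : ∀ f : EuclideanSpace ℝ (Fin N) → ℝ,
      ∫ x in (Ω : Set (EuclideanSpace ℝ (Fin N))), f x * (gradient φ x) i =
      ∫ x in K, inner ℝ ((gradient φ x) i) (f x) := by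
    intro f
    rw [setIntegral_eq_of_subset_opens (hφ ▸ φ.tsupport_subset)]
    · rfl
    · intro x hx
      rw [gradient_eq_zero_of_notMem_tsupport (hφ ▸ hx)]
      simp
  simp_rw [e]
  exact tendsto_integral_inner hw hu (hc.memLp_restrict_isCompact hK) h

theorem tendsto_integral_mul_test {K : Set (EuclideanSpace ℝ (Fin N))} (hK : IsCompact K)
    {w : ℕ → EuclideanSpace ℝ (Fin N) → EuclideanSpace ℝ (Fin N)}
    (hw : ∀ n, MemLp (w n) 2 (volume.restrict K)) (hu : MemLp g 2 (volume.restrict K))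
    (h : Tendsto (fun n => eLpNorm (fun x => w n x - g x) 2 (volume.restrict K)) atTop (𝓝 0))
    (φ : TestFunction Ω ℝ ⊤) (hφ : tsupport φ = K) (i : Fin N) :
    Tendsto (fun n => ∫ x in (Ω : Set (EuclideanSpace ℝ (Fin N))), w n x i * φ x) atTop
      (𝓝 (∫ x in (Ω : Set (EuclideanSpace ℝ (Fin N))), g x i * φ x)) := by
  have hc : Continuous fun x => EuclideanSpace.single i (φ x) := by
    have : (fun x => EuclideanSpace.single i (φ x)) =
        fun x => φ x • (EuclideanSpace.single i (1 : ℝ)) := by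
      ext x j
      simp
    rw [this]
    exact φ.continuous.smul continuous_const
  have e : ∀ f : EuclideanSpace ℝ (Fin N) → EuclideanSpace ℝ (Fin N),
      ∫ x in (Ω : Set (EuclideanSpace ℝ (Fin N))), f x i * φ x =
      ∫ x in K, inner ℝ (EuclideanSpace.single i (φ x)) (f x) := by
    intro f
    rw [setIntegral_eq_of_subset_opens (hφ ▸ φ.tsupport_subset)]
    · simp [EuclideanSpace.inner_single_left, mul_comm]
    · intro x hx
      have hx' : x ∉ tsupport φ := hφ ▸ hx
      simp [image_eq_zero_of_notMem_tsupport hx']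
  simp_rw [e]
  exact tendsto_integral_inner hw hu (hc.memLp_restrict_isCompact hK) h

/-- Integration by parts passes to limits in `L²` on compact subsets. -/
theorem IsH1LocGradient.of_tendsto
    (h : ∀ K : Set (EuclideanSpace ℝ (Fin N)), IsCompact K → K ⊆ Ω →
      MemLp u 2 (volume.restrict K) ∧ MemLp g 2 (volume.restrict K) ∧
      ∃ (w : ℕ → EuclideanSpace ℝ (Fin N) → ℝ)
        (γ : ℕ → EuclideanSpace ℝ (Fin N) → EuclideanSpace ℝ (Fin N)),
        (∀ n, MemLp (w n) 2 (volume.restrict K)) ∧ (∀ n, MemLp (γ n) 2 (volume.restrict K)) ∧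
        (∀ n, ∀ (φ : TestFunction Ω ℝ ⊤) (i : Fin N),
          ∫ x in (Ω : Set (EuclideanSpace ℝ (Fin N))), w n x * (gradient φ x) i =
          -∫ x in (Ω : Set (EuclideanSpace ℝ (Fin N))), γ n x i * φ x) ∧
        Tendsto (fun n => eLpNorm (fun x => w n x - u x) 2 (volume.restrict K)) atTop (𝓝 0) ∧
        Tendsto (fun n => eLpNorm (fun x => γ n x - g x) 2 (volume.restrict K)) atTop (𝓝 0)) :
    IsH1LocGradient Ω u g := by
  refine ⟨⟨locallyIntegrableOn_of_memLp_two fun K hK hKΩ => (h K hK hKΩ).1,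
    locallyIntegrableOn_of_memLp_two fun K hK hKΩ => (h K hK hKΩ).2.1, fun φ i => ?_⟩,
    fun K hK hKΩ => (h K hK hKΩ).1, fun K hK hKΩ => (h K hK hKΩ).2.1⟩
  obtain ⟨hu, hg, w, γ, hw, hγ, hibp, hwu, hγg⟩ :=
    h _ φ.hasCompactSupport.isCompact φ.tsupport_subset
  refine tendsto_nhds_unique
    (tendsto_integral_mul_gradient φ.hasCompactSupport.isCompact hw hu hwu φ rfl i) ?_
  simp_rw [hibp]
  exact (tendsto_integral_mul_test φ.hasCompactSupport.isCompact hγ hg hγg φ rfl i).neg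

theorem memLp_comp_lipschitz {F : ℝ → ℝ} {C : ℝ≥0} (hF : LipschitzWith C F)
    {K : Set (EuclideanSpace ℝ (Fin N))} (hK : IsCompact K) (hu : MemLp u 2 (volume.restrict K)) :
    MemLp (fun x => F (u x)) 2 (volume.restrict K) := by
  have : IsFiniteMeasure (volume.restrict K) := ⟨by simpa using hK.measure_lt_top⟩
  have h0 : MemLp (fun x => F (u x) - F 0) 2 (volume.restrict K) := by
    refine hu.of_le_mul (c := C)
      ((hF.continuous.comp_aestronglyMeasurable hu.1).sub aestronglyMeasurable_const)
      (Eventually.of_forall fun x => ?_)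
    simpa using hF.norm_sub_le (u x) 0
  have := h0.add (memLp_const (F 0))
  refine this.congr_norm (hF.continuous.comp_aestronglyMeasurable hu.1)
    (Eventually.of_forall fun x => ?_)
  simp

theorem LipschitzWith.abs_le_of_hasDerivWithinAt {F : ℝ → ℝ} {C : ℝ≥0} (hF : LipschitzWith C F)
    {s a : ℝ} (h : HasDerivWithinAt F a (Set.Ici s) s) : |a| ≤ C := by
  have h1 : HasDerivWithinAt F a (Set.Ioi s) s := h.mono Set.Ioi_subset_Ici_self
  have h2 := (hasDerivWithinAt_iff_tendsto_slope' (Set.self_notMem_Ioi)).1 h1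
  refine le_of_tendsto h2.abs (eventually_nhdsWithin_of_forall fun t ht => ?_)
  have ht' : 0 < |t - s| := abs_pos.2 (sub_ne_zero.2 (ne_of_gt ht))
  rw [slope_def_field, abs_div, div_le_iff₀ ht']
  simpa [Real.dist_eq] using hF.dist_le_mul t s

theorem gradient_comp {F : ℝ → ℝ} {h : ℝ} {w : EuclideanSpace ℝ (Fin N) → ℝ}
    {x : EuclideanSpace ℝ (Fin N)} (hF : HasDerivAt F h (w x)) (hw : DifferentiableAt ℝ w x) :
    gradient (fun y => F (w y)) x = h • gradient w x := by
  ext i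
  have h1 : HasFDerivAt (fun y => F (w y)) (h • fderiv ℝ w x) x :=
    hF.comp_hasFDerivAt x hw.hasFDerivAt
  rw [gradient_apply, h1.fderiv]
  simp [gradient_apply]

/-- For smooth mollifications `uₙ` the classical chain rule holds. As `h` is bounded and continuous,
`h(uₙ) ∇uₙ` converges in `L²` on compact sets. -/
theorem IsH1LocGradient.comp_of_continuous_deriv (H : IsH1LocGradient Ω u g) {F h : ℝ → ℝ}
    {C : ℝ≥0} (hF : LipschitzWith C F) (hd : ∀ s, HasDerivAt F (h s) s) (hc : Continuous h) :
    IsH1LocGradient Ω (fun x => F (u x)) (fun x => h (u x) • g x) := by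
  have hbd : ∀ s, |h s| ≤ C := fun s => hF.abs_le_of_hasDerivWithinAt (hd s).hasDerivWithinAt
  have hF1 : ContDiff ℝ 1 F := by
    rw [contDiff_one_iff_deriv]
    refine ⟨fun s => (hd s).differentiableAt, ?_⟩
    rwa [show deriv F = h from funext fun s => (hd s).deriv]
  refine IsH1LocGradient.of_tendsto fun K hK hKΩ => ?_
  have hu := H.memLp_fun K hK hKΩ
  have hg := H.memLp_grad K hK hKΩ
  obtain ⟨K', hli, hL2, hgrad, hae⟩ := H.exists_mollify_tendsto hK hKΩ
  have hsm : ∀ n, ContDiff ℝ 1 (mollify n (K'.indicator u)) := fun n =>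
    (contDiff_mollify n hli).of_le (by exact_mod_cast le_top)
  have hθ : AEStronglyMeasurable (fun x => h (u x)) (volume.restrict K) :=
    hc.comp_aestronglyMeasurable hu.1
  refine ⟨memLp_comp_lipschitz hF hK hu, hg.bdd_smul hθ (Eventually.of_forall fun x => hbd _),
    fun n x => F (mollify n (K'.indicator u) x),
    fun n x => h (mollify n (K'.indicator u) x) • gradient (mollify n (K'.indicator u)) x,
    fun n => (hF1.continuous.comp (hsm n).continuous).memLp_restrict_isCompact hK,
    fun n => ((hc.comp (hsm n).continuous).smul
      (hsm n).continuous_gradient).memLp_restrict_isCompact hK, fun n φ i => ?_, ?_, ?_⟩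
  · rw [integral_mul_gradient_of_contDiff (w := fun x => F (mollify n (K'.indicator u) x))
      (hF1.comp (hsm n)) φ i]
    congr 1
    refine integral_congr_ae (Eventually.of_forall fun x => ?_)
    simp only
    rw [gradient_comp (hd _) ((hsm n).differentiable one_ne_zero x)]
  · have hb : Tendsto (fun n => ENNReal.ofReal C * eLpNorm
        (fun x => mollify n (K'.indicator u) x - u x) 2 (volume.restrict K)) atTop (𝓝 0) := by
      simpa using ENNReal.Tendsto.const_mul (a := ENNReal.ofReal C) hL2
        (Or.inr ENNReal.ofReal_ne_top)
    refine tendsto_of_tendsto_of_tendsto_of_le_of_le tendsto_const_nhds hb (fun _ => zero_le)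
      (fun n => eLpNorm_le_mul_eLpNorm_of_ae_le_mul (Eventually.of_forall fun x => ?_) 2)
    exact hF.norm_sub_le _ _
  · exact tendsto_eLpNorm_smul_sub (C := C)
      (fun n => (hc.comp (hsm n).continuous).aestronglyMeasurable) hθ
      (fun n => Eventually.of_forall fun x => hbd _)
      (hae.mono fun x hx => (hc.tendsto _).comp hx)
      (fun n => (hsm n).continuous_gradient.aestronglyMeasurable) hg hgrad

/-- The average of `F` over `[s, s + 1 / (n + 1)]`. -/
noncomputable def forwardAverage (F : ℝ → ℝ) (n : ℕ) (s : ℝ) : ℝ :=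
  ((n : ℝ) + 1) * ∫ t in s..(s + 1 / ((n : ℝ) + 1)), F t

theorem hasDerivAt_forwardAverage {F : ℝ → ℝ} (hF : Continuous F) (n : ℕ) (s : ℝ) :
    HasDerivAt (forwardAverage F n)
      (((n : ℝ) + 1) * (F (s + 1 / ((n : ℝ) + 1)) - F s)) s := by
  have h1 : HasDerivAt (fun s => ∫ t in (0 : ℝ)..s, F t) (F s) s :=
    (hF.integral_hasStrictDerivAt 0 s).hasDerivAt
  have h2 : HasDerivAt (fun s => ∫ t in (0 : ℝ)..(s + 1 / ((n : ℝ) + 1)), F t)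
      (F (s + 1 / ((n : ℝ) + 1))) s :=
    (hF.integral_hasStrictDerivAt 0 (s + 1 / ((n : ℝ) + 1))).hasDerivAt.comp_add_const _ _
  have h3 := (h2.sub h1).const_mul ((n : ℝ) + 1)
  refine h3.congr_of_eventuallyEq (Eventually.of_forall fun r => ?_)
  simp only [forwardAverage, Pi.sub_apply]
  rw [intervalIntegral.integral_interval_sub_left (hF.intervalIntegrable _ _)
    (hF.intervalIntegrable _ _)]

theorem LipschitzWith.forwardAverage_deriv_le {F : ℝ → ℝ} {C : ℝ≥0} (hF : LipschitzWith C F)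
    (n : ℕ) (s : ℝ) : |((n : ℝ) + 1) * (F (s + 1 / ((n : ℝ) + 1)) - F s)| ≤ C := by
  have hn : (0 : ℝ) < (n : ℝ) + 1 := by positivity
  have := hF.dist_le_mul (s + 1 / ((n : ℝ) + 1)) s
  rw [Real.dist_eq, Real.dist_eq, add_sub_cancel_left,
    abs_of_pos (by positivity : 0 < 1 / ((n : ℝ) + 1))] at this
  rw [abs_mul, abs_of_pos hn]
  calc _ ≤ ((n : ℝ) + 1) * (C * (1 / ((n : ℝ) + 1))) := by gcongr
    _ = C := by field_simp

theorem LipschitzWith.forwardAverage {F : ℝ → ℝ} {C : ℝ≥0} (hF : LipschitzWith C F) (n : ℕ) :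
    LipschitzWith C (forwardAverage F n) :=
  lipschitzWith_of_nnnorm_deriv_le
    (fun s => (hasDerivAt_forwardAverage hF.continuous n s).differentiableAt) fun s => by
      rw [(hasDerivAt_forwardAverage hF.continuous n s).deriv]
      exact hF.forwardAverage_deriv_le n s

theorem LipschitzWith.abs_forwardAverage_sub_le {F : ℝ → ℝ} {C : ℝ≥0} (hF : LipschitzWith C F)
    (n : ℕ) (s : ℝ) : |_root_.forwardAverage F n s - F s| ≤ C * (1 / ((n : ℝ) + 1)) := by
  have hn : (0 : ℝ) < (n : ℝ) + 1 := by positivity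
  have hn' : (0 : ℝ) < 1 / ((n : ℝ) + 1) := by positivity
  have e : _root_.forwardAverage F n s - F s =
      ((n : ℝ) + 1) * ∫ t in s..(s + 1 / ((n : ℝ) + 1)), (F t - F s) := by
    rw [intervalIntegral.integral_sub (hF.continuous.intervalIntegrable _ _)
      (continuous_const.intervalIntegrable _ _), mul_sub, intervalIntegral.integral_const,
      _root_.forwardAverage, add_sub_cancel_left, smul_eq_mul]
    field_simp
  have b := intervalIntegral.norm_integral_le_of_norm_le_const (a := s)
    (b := s + 1 / ((n : ℝ) + 1)) (f := fun t => F t - F s) (C := C * (1 / ((n : ℝ) + 1)))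
    fun t ht => by
      rw [Set.uIoc_of_le (by linarith)] at ht
      refine (hF.norm_sub_le t s).trans ?_
      gcongr
      rw [Real.norm_eq_abs, abs_of_pos (by linarith [ht.1])]
      linarith [ht.2]
  rw [add_sub_cancel_left, abs_of_pos hn', Real.norm_eq_abs] at b
  rw [e, abs_mul, abs_of_pos hn]
  calc _ ≤ ((n : ℝ) + 1) * (C * (1 / ((n : ℝ) + 1)) * (1 / ((n : ℝ) + 1))) := by gcongr
    _ = _ := by field_simp

/-- The forward quotient is the derivative of the `C¹` function `forwardAverage F n`. Convergence at
every `s`, and not just almost every `s`, matters: it can be evaluated at `s = u x` without knowing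
that `∇u` vanishes on level sets. -/
theorem tendsto_forwardAverage_deriv {F : ℝ → ℝ} {a s : ℝ}
    (h : HasDerivWithinAt F a (Set.Ici s) s) :
    Tendsto (fun n : ℕ => ((n : ℝ) + 1) * (F (s + 1 / ((n : ℝ) + 1)) - F s)) atTop (𝓝 a) := by
  have h1 : HasDerivWithinAt F a (Set.Ioi s) s := h.mono Set.Ioi_subset_Ici_self
  have h2 := (hasDerivWithinAt_iff_tendsto_slope' (Set.self_notMem_Ioi)).1 h1
  have h3 : Tendsto (fun n : ℕ => s + 1 / ((n : ℝ) + 1)) atTop (𝓝[>] s) := by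
    refine tendsto_nhdsWithin_iff.2 ⟨?_, Eventually.of_forall fun n => ?_⟩
    · simpa using (tendsto_one_div_add_atTop_nhds_zero_nat (𝕜 := ℝ)).const_add s
    · have : (0 : ℝ) < 1 / ((n : ℝ) + 1) := by positivity
      simpa using this
  refine (h2.comp h3).congr fun n => ?_
  simp only [Function.comp, slope_def_field]
  field_simp
  simp

theorem measurable_of_hasDerivWithinAt_Ici {F h : ℝ → ℝ} (hF : Continuous F)
    (hh : ∀ s, HasDerivWithinAt F (h s) (Set.Ici s) s) : Measurable h :=
  measurable_of_tendsto_metrizable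
    (f := fun (n : ℕ) s => ((n : ℝ) + 1) * (F (s + 1 / ((n : ℝ) + 1)) - F s))
    (fun n => by fun_prop) (tendsto_pi_nhds.2 fun s => tendsto_forwardAverage_deriv (hh s))

/-- Chain rule for a Lipschitz function with a right derivative at each point. -/
theorem IsH1LocGradient.comp (H : IsH1LocGradient Ω u g) {F h : ℝ → ℝ} {C : ℝ≥0}
    (hF : LipschitzWith C F) (hh : ∀ s, HasDerivWithinAt F (h s) (Set.Ici s) s) :
    IsH1LocGradient Ω (fun x => F (u x)) (fun x => h (u x) • g x) := by
  have hmeas := measurable_of_hasDerivWithinAt_Ici hF.continuous hh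
  have hbd : ∀ s, |h s| ≤ C := fun s => hF.abs_le_of_hasDerivWithinAt (hh s)
  have hcomp : ∀ n : ℕ, IsH1LocGradient Ω (fun x => forwardAverage F n (u x))
      (fun x => (((n : ℝ) + 1) * (F (u x + 1 / ((n : ℝ) + 1)) - F (u x))) • g x) := fun n =>
    H.comp_of_continuous_deriv (hF.forwardAverage n)
      (hasDerivAt_forwardAverage hF.continuous n)
      (by have := hF.continuous; fun_prop)
  refine IsH1LocGradient.of_tendsto fun K hK hKΩ => ?_
  have : IsFiniteMeasure (volume.restrict K) := ⟨by simpa using hK.measure_lt_top⟩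
  have hu := H.memLp_fun K hK hKΩ
  have hg := H.memLp_grad K hK hKΩ
  have hθ : AEStronglyMeasurable (fun x => h (u x)) (volume.restrict K) :=
    (hmeas.comp_aemeasurable hu.1.aemeasurable).aestronglyMeasurable
  refine ⟨memLp_comp_lipschitz hF hK hu, hg.bdd_smul hθ (Eventually.of_forall fun x => hbd _),
    _, _, fun n => (hcomp n).memLp_fun K hK hKΩ, fun n => (hcomp n).memLp_grad K hK hKΩ,
    fun n => (hcomp n).isWeakGradient.integral_eq, ?_, ?_⟩
  · refine tendsto_eLpNorm_two_of_dominated (b := fun _ => (C : ℝ))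
      (fun n => ((hcomp n).memLp_fun K hK hKΩ).1.sub (memLp_comp_lipschitz hF hK hu).1)
      (memLp_const _) (fun n => Eventually.of_forall fun x => ?_)
      (Eventually.of_forall fun x => ?_)
    · refine (hF.abs_forwardAverage_sub_le n (u x)).trans ?_
      refine mul_le_of_le_one_right C.2 ?_
      rw [div_le_one (by positivity)]
      linarith [(Nat.cast_nonneg n : (0 : ℝ) ≤ n)]
    · have hz : Tendsto (fun n : ℕ => (C : ℝ) * (1 / ((n : ℝ) + 1))) atTop (𝓝 0) := by
        simpa using tendsto_one_div_add_atTop_nhds_zero_nat.const_mul (C : ℝ)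
      exact squeeze_zero_norm (fun n => hF.abs_forwardAverage_sub_le n (u x)) hz
  · refine tendsto_eLpNorm_smul_sub (C := C) (γ := fun _ => g) (fun n => ?_) hθ
      (fun n => Eventually.of_forall fun x => hF.forwardAverage_deriv_le n (u x))
      (Eventually.of_forall fun x => tendsto_forwardAverage_deriv (hh (u x)))
      (fun _ => hg.1) hg (by simp)
    exact (by have := hF.continuous; fun_prop :
      Continuous fun s =>
        ((n : ℝ) + 1) * (F (s + 1 / ((n : ℝ) + 1)) - F s)).comp_aestronglyMeasurable
        hu.1

theorem IsH1LocGradient.sub (H : IsH1LocGradient Ω u g) (H' : IsH1LocGradient Ω v γ) :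
    IsH1LocGradient Ω (fun x => u x - v x) (fun x => g x - γ x) := by
  refine ⟨⟨H.1.1.sub H'.1.1, H.1.2.sub H'.1.2, fun φ i => ?_⟩,
    fun K hK hKΩ => (H.memLp_fun K hK hKΩ).sub (H'.memLp_fun K hK hKΩ),
    fun K hK hKΩ => (H.memLp_grad K hK hKΩ).sub (H'.memLp_grad K hK hKΩ)⟩
  have hK := φ.hasCompactSupport.isCompact
  have hKΩ := φ.tsupport_subset
  have e1 : ∀ {a : EuclideanSpace ℝ (Fin N) → ℝ}, MemLp a 2 (volume.restrict (tsupport φ)) →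
      IntegrableOn (fun x => a x * (gradient φ x) i) Ω := fun {a} ha => by
    refine IntegrableOn.of_forall_sdiff_eq_zero
      ((memLp_two_integrableOn hK ha).mul_continuousOn ((EuclideanSpace.proj (𝕜 := ℝ)
        i).continuous.comp φ.contDiff_one.continuous_gradient).continuousOn hK)
      Ω.isOpen.measurableSet fun x hx => ?_
    simp [gradient_eq_zero_of_notMem_tsupport hx.2]
  have e2 : ∀ {a : EuclideanSpace ℝ (Fin N) → EuclideanSpace ℝ (Fin N)},
      MemLp a 2 (volume.restrict (tsupport φ)) →
      IntegrableOn (fun x => a x i * φ x) Ω := fun {a} ha => by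
    have hi : IntegrableOn (fun x => a x i) (tsupport φ) :=
      (EuclideanSpace.proj (𝕜 := ℝ) i).integrable_comp (memLp_two_integrableOn hK ha)
    refine IntegrableOn.of_forall_sdiff_eq_zero
      (hi.mul_continuousOn φ.continuous.continuousOn hK) Ω.isOpen.measurableSet fun x hx => ?_
    simp [image_eq_zero_of_notMem_tsupport hx.2]
  simp only [sub_mul, PiLp.sub_apply]
  rw [integral_sub (e1 (H.memLp_fun _ hK hKΩ)) (e1 (H'.memLp_fun _ hK hKΩ)),
    integral_sub (e2 (H.memLp_grad _ hK hKΩ)) (e2 (H'.memLp_grad _ hK hKΩ)),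
    H.1.integral_eq, H'.1.integral_eq]
  ring

end ChainRule

/-! ### Compactly supported functions: approximation, testing, Poincaré's inequality. -/

section CompactSupport

variable {N : ℕ} {Ω : Opens (EuclideanSpace ℝ (Fin N))} {u w : EuclideanSpace ℝ (Fin N) → ℝ}
  {g γ : EuclideanSpace ℝ (Fin N) → EuclideanSpace ℝ (Fin N)}

theorem eLpNorm_restrict_eq_of_forall_notMem {G : Type*} [NormedAddCommGroup G]
    {F : EuclideanSpace ℝ (Fin N) → G} {K : Set (EuclideanSpace ℝ (Fin N))} (hK : IsCompact K)
    (hKΩ : K ⊆ Ω) (hF : ∀ x, x ∉ K → F x = 0) :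
    eLpNorm F 2 (volume.restrict (Ω : Set (EuclideanSpace ℝ (Fin N)))) =
      eLpNorm F 2 (volume.restrict K) := by
  have e : F = K.indicator F := by
    ext x
    by_cases hx : x ∈ K
    · rw [Set.indicator_of_mem hx]
    · rw [Set.indicator_of_notMem hx, hF x hx]
  rw [e, eLpNorm_indicator_eq_eLpNorm_restrict hK.measurableSet,
    eLpNorm_indicator_eq_eLpNorm_restrict hK.measurableSet,
    Measure.restrict_restrict hK.measurableSet, Set.inter_eq_left.2 hKΩ,
    Measure.restrict_restrict hK.measurableSet, Set.inter_self]

/-- Mollification enlarges the support by at most the radius, and averaging preserves pointwise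
bounds, so suitable mollifications are test functions with a common compact support. -/
theorem IsH1LocGradient.exists_testFunction_tendsto (H : IsH1LocGradient Ω w γ)
    {K : Set (EuclideanSpace ℝ (Fin N))} (hK : IsCompact K) (hKΩ : K ⊆ Ω)
    (hw0 : ∀ x, x ∉ K → w x = 0) (hγ0 : ∀ x, x ∉ K → γ x = 0) :
    ∃ K₁ : Set (EuclideanSpace ℝ (Fin N)), IsCompact K₁ ∧ K₁ ⊆ Ω ∧ K ⊆ K₁ ∧
      ∃ φ : ℕ → TestFunction Ω ℝ ⊤, (∀ n, tsupport (φ n) ⊆ K₁) ∧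
      (∀ M : ℝ, (∀ x, |w x| ≤ M) → ∀ n x, |φ n x| ≤ M) ∧
      Tendsto (fun n => eLpNorm (fun x => φ n x - w x) 2 (volume.restrict Ω)) atTop (𝓝 0) ∧
      Tendsto (fun n => eLpNorm (fun x => gradient (φ n) x - γ x) 2 (volume.restrict Ω))
        atTop (𝓝 0) ∧
      ∀ᵐ x ∂(volume.restrict K₁), Tendsto (fun n => φ n x) atTop (𝓝 (w x)) := by
  obtain ⟨δ, hδ, hδΩ⟩ := hK.exists_cthickening_subset_open Ω.isOpen hKΩ
  set K₁ := Metric.cthickening δ K with hK₁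
  have hK₁c : IsCompact K₁ := hK.cthickening
  obtain ⟨K', hli, hL2, hgrad, hae⟩ := H.exists_mollify_tendsto hK₁c hδΩ
  obtain ⟨n₀, hn₀⟩ := eventually_atTop.1
    ((tendsto_one_div_add_atTop_nhds_zero_nat (𝕜 := ℝ)).eventually (ge_mem_nhds hδ))
  have hsupp : ∀ n, n₀ ≤ n → tsupport (mollify n (K'.indicator w)) ⊆ K₁ := by
    intro n hn
    refine closure_minimal (fun x hx => by_contra fun h' => hx ?_) Metric.isClosed_cthickening
    refine mollify_eq_zero n fun y hy => ?_
    have hyK : y ∉ K := fun hyK => h'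
      (Metric.mem_cthickening_of_dist_le x y δ K hyK (hy.le.trans (hn₀ n hn)))
    by_cases hy' : y ∈ K'
    · rw [Set.indicator_of_mem hy', hw0 y hyK]
    · rw [Set.indicator_of_notMem hy']
  -- The shift by `n₀` discards the radii larger than `δ`.
  let φ : ℕ → TestFunction Ω ℝ ⊤ := fun n => ⟨mollify (n + n₀) (K'.indicator w),
    contDiff_mollify _ hli,
    hK₁c.of_isClosed_subset (isClosed_tsupport _) (hsupp _ (Nat.le_add_left _ _)),
    (hsupp _ (Nat.le_add_left _ _)).trans hδΩ⟩
  have hφs : ∀ n, tsupport (φ n) ⊆ K₁ := fun n => hsupp _ (Nat.le_add_left _ _)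
  have hKK₁ : K ⊆ K₁ := Metric.self_subset_cthickening _
  refine ⟨K₁, hK₁c, hδΩ, hKK₁, φ, hφs, fun M hM n x => ?_, ?_, ?_, ?_⟩
  · refine norm_mollify_le (n + n₀) (g := K'.indicator w) (fun y => ?_) x
    by_cases hy : y ∈ K'
    · rw [Set.indicator_of_mem hy]
      exact hM y
    · rw [Set.indicator_of_notMem hy, norm_zero]
      exact (abs_nonneg _).trans (hM y)
  · refine ((tendsto_add_atTop_iff_nat n₀).2 hL2).congr fun n => ?_
    refine (eLpNorm_restrict_eq_of_forall_notMem hK₁c hδΩ fun x hx => ?_).symm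
    change φ n x - w x = 0
    rw [image_eq_zero_of_notMem_tsupport fun h => hx (hφs n h), hw0 x fun h => hx (hKK₁ h),
      sub_zero]
  · refine ((tendsto_add_atTop_iff_nat n₀).2 hgrad).congr fun n => ?_
    refine (eLpNorm_restrict_eq_of_forall_notMem hK₁c hδΩ fun x hx => ?_).symm
    change gradient (φ n) x - γ x = 0
    rw [gradient_eq_zero_of_notMem_tsupport fun h => hx (hφs n h), hγ0 x fun h => hx (hKK₁ h),
      sub_zero]
  · filter_upwards [hae] with x hx
    exact hx.comp (tendsto_add_atTop_nat n₀)

/-- A weak formulation with test functions in `C¹_c` extends to bounded test functions in `H¹` with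
compact support. -/
theorem integral_inner_eq_of_forall_testFunction {h : EuclideanSpace ℝ (Fin N) → ℝ}
    (hg : ∀ K : Set (EuclideanSpace ℝ (Fin N)), IsCompact K → K ⊆ Ω →
      MemLp g 2 (volume.restrict K))
    (hh : LocallyIntegrableOn h Ω)
    (hweak : ∀ φ : TestFunction Ω ℝ 1,
      ∫ x in (Ω : Set (EuclideanSpace ℝ (Fin N))), inner ℝ (g x) (gradient φ x) =
        ∫ x in (Ω : Set (EuclideanSpace ℝ (Fin N))), h x * φ x)
    (H : IsH1LocGradient Ω w γ) {K : Set (EuclideanSpace ℝ (Fin N))} (hK : IsCompact K)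
    (hKΩ : K ⊆ Ω) (hw0 : ∀ x, x ∉ K → w x = 0) (hγ0 : ∀ x, x ∉ K → γ x = 0) {M : ℝ}
    (hM : ∀ x, |w x| ≤ M) :
    ∫ x in K, inner ℝ (g x) (γ x) = ∫ x in K, h x * w x := by
  obtain ⟨K₁, hK₁, hK₁Ω, hKK₁, φ, hφs, hφM, hL2, hgrad, hae⟩ :=
    H.exists_testFunction_tendsto hK hKΩ hw0 hγ0
  have r1 : Tendsto (fun n => ∫ x in K₁, inner ℝ (g x) (gradient (φ n) x)) atTop
      (𝓝 (∫ x in K₁, inner ℝ (g x) (γ x))) := by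
    refine tendsto_integral_inner
      (fun n => (φ n).contDiff_one.continuous_gradient.memLp_restrict_isCompact hK₁)
      (H.memLp_grad K₁ hK₁ hK₁Ω) (hg K₁ hK₁ hK₁Ω)
      (tendsto_of_tendsto_of_tendsto_of_le_of_le tendsto_const_nhds hgrad (fun _ => zero_le)
        (fun n => eLpNorm_mono_measure _ (Measure.restrict_mono_set _ hK₁Ω)))
  have hhK : IntegrableOn h K₁ := hh.integrableOn_compact_subset hK₁Ω hK₁
  -- Here `h` is only locally integrable, so `L²` convergence of `φ n` is not enough; the uniform
  -- bound `M` supplies domination.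
  have r2 : Tendsto (fun n => ∫ x in K₁, h x * φ n x) atTop (𝓝 (∫ x in K₁, h x * w x)) := by
    refine tendsto_integral_of_dominated_convergence (fun x => ‖h x‖ * M)
      (fun n => hhK.1.mul (φ n).continuous.aestronglyMeasurable) (hhK.norm.mul_const M)
      (fun n => Eventually.of_forall fun x => ?_) (hae.mono fun x hx => hx.const_mul (h x))
    rw [norm_mul]
    exact mul_le_mul_of_nonneg_left (hφM M hM n x) (norm_nonneg _)
  have r3 : ∀ n, ∫ x in K₁, inner ℝ (g x) (gradient (φ n) x) = ∫ x in K₁, h x * φ n x := by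
    intro n
    have := hweak ⟨φ n, (φ n).contDiff_one, (φ n).hasCompactSupport, (φ n).tsupport_subset⟩
    rw [setIntegral_eq_of_subset_opens hK₁Ω, setIntegral_eq_of_subset_opens hK₁Ω] at this
    · exact this
    · intro x hx
      change h x * φ n x = 0
      rw [image_eq_zero_of_notMem_tsupport fun h' => hx (hφs n h'), mul_zero]
    · intro x hx
      change inner ℝ (g x) (gradient (φ n) x) = 0
      rw [gradient_eq_zero_of_notMem_tsupport fun h' => hx (hφs n h'), inner_zero_right]
  simp_rw [r3] at r1
  have r4 := tendsto_nhds_unique r1 r2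
  rw [setIntegral_eq_of_subset_of_forall_sdiff_eq_zero hK₁.measurableSet hKK₁,
    setIntegral_eq_of_subset_of_forall_sdiff_eq_zero hK₁.measurableSet hKK₁] at r4
  · exact r4
  · intro x hx
    rw [hw0 x hx.2, mul_zero]
  · intro x hx
    rw [hγ0 x hx.2, inner_zero_right]

/-- Poincaré's inequality for test functions. -/
theorem TestFunction.eLpNorm_le (hN : 0 < N) {R : ℝ} (hR : 0 ≤ R)
    (hΩ : ∀ x ∈ Ω, ‖x‖ ≤ R) (φ : TestFunction Ω ℝ ⊤) :
    eLpNorm φ 2 (volume.restrict Ω) ≤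
      ENNReal.ofReal (2 * R) * eLpNorm (gradient φ) 2 (volume.restrict Ω) := by
  set i : Fin N := ⟨0, hN⟩
  have hs := φ.hasCompactSupport
  have hΩφ : ∀ x, x ∉ tsupport φ → φ x = 0 := fun x => image_eq_zero_of_notMem_tsupport
  rw [eLpNorm_restrict_eq_of_forall_notMem hs.isCompact φ.tsupport_subset hΩφ,
    eLpNorm_restrict_eq_of_forall_notMem hs.isCompact φ.tsupport_subset
      fun x => gradient_eq_zero_of_notMem_tsupport]
  have hm1 := φ.continuous.memLp_restrict_isCompact hs.isCompact
  have hm2 := φ.contDiff_one.continuous_gradient.memLp_restrict_isCompact hs.isCompact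
  set e := EuclideanSpace.single i (1 : ℝ) with he
  have hφd : Differentiable ℝ φ := φ.contDiff_one.differentiable one_ne_zero
  have hsq : ∀ x, fderiv ℝ (fun y => φ y ^ 2) x e = 2 * φ x * (gradient φ x) i := by
    intro x
    have := (hφd x).hasFDerivAt.pow 2
    rw [this.fderiv, gradient_apply]
    simp [he]
  have hci : Continuous fun x => (gradient φ x) i :=
    (EuclideanSpace.proj (𝕜 := ℝ) i).continuous.comp φ.contDiff_one.continuous_gradient
  have hxi : Continuous fun x : EuclideanSpace ℝ (Fin N) => x i :=
    (EuclideanSpace.proj (𝕜 := ℝ) i).continuous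
  have hcoord : ∀ x, fderiv ℝ (fun y : EuclideanSpace ℝ (Fin N) => y i) x e = 1 := by
    intro x
    have : HasFDerivAt (fun y : EuclideanSpace ℝ (Fin N) => y i)
      (EuclideanSpace.proj (𝕜 := ℝ) i) x := (EuclideanSpace.proj (𝕜 := ℝ) i).hasFDerivAt
    rw [this.fderiv]
    simp [he]
  -- Integrate by parts against the coordinate `x i`, whose `i`-th derivative is `1`.
  have key : ∫ x in tsupport φ, φ x ^ 2 = -∫ x in tsupport φ, 2 * φ x * (gradient φ x) i * x i := by
    rw [setIntegral_eq_integral_of_forall_compl_eq_zero (fun x hx => by simp [hΩφ x hx]),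
      setIntegral_eq_integral_of_forall_compl_eq_zero (fun x hx => by simp [hΩφ x hx])]
    have hsqs : HasCompactSupport fun x => φ x ^ 2 := by
      simp_rw [pow_two]
      exact hs.mul_right (f' := φ)
    have hint : Integrable fun x => φ x ^ 2 := by
      refine (φ.continuous.pow 2).integrable_of_hasCompactSupport ?_
      exact hsqs
    have h := integral_mul_fderiv_eq_neg_fderiv_mul_of_integrable (μ := volume)
      (f := fun x => φ x ^ 2) (g := fun x : EuclideanSpace ℝ (Fin N) => x i) (v := e)
      (by
        simp_rw [hsq]
        refine (((continuous_const.mul φ.continuous).mul hci).mul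
          hxi).integrable_of_hasCompactSupport ?_
        exact (hs.mul_left.mul_right).mul_right)
      (by simpa only [hcoord, mul_one] using hint)
      (by
        refine ((φ.continuous.pow 2).mul hxi).integrable_of_hasCompactSupport ?_
        exact hsqs.mul_right)
      (fun x _ => (hφd x).pow 2)
      (fun x _ => (EuclideanSpace.proj (𝕜 := ℝ) i).differentiableAt)
    simpa only [hsq, hcoord, mul_one] using h
  have hi1 : Integrable (fun x => φ x ^ 2) (volume.restrict (tsupport φ)) := hm1.integrable_sq
  have hi2 : Integrable (fun x => ‖gradient φ x‖ ^ 2) (volume.restrict (tsupport φ)) :=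
    hm2.norm.integrable_sq
  have hineq : ∫ x in tsupport φ, φ x ^ 2 ≤
      (2 * R) ^ 2 * ∫ x in tsupport φ, ‖gradient φ x‖ ^ 2 := by
    -- Young's inequality leaves `1 / 2 * φ x ^ 2` to be absorbed on the left, which gives the
    -- constant `(2 * R) ^ 2`.
    have h1 : -∫ x in tsupport φ, 2 * φ x * (gradient φ x) i * x i ≤
        ∫ x in tsupport φ, (1 / 2 * φ x ^ 2 + 2 * R ^ 2 * ‖gradient φ x‖ ^ 2) := by
      rw [← integral_neg]
      refine setIntegral_mono_on ?_ ((hi1.const_mul _).add (hi2.const_mul _))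
        hs.isCompact.measurableSet fun x hx => ?_
      · exact ((((continuous_const.mul φ.continuous).mul hci).mul
          hxi).continuousOn.integrableOn_compact hs.isCompact).neg
      · have hxR : |x i| ≤ R := (PiLp.norm_apply_le x i).trans (hΩ x (φ.tsupport_subset hx))
        have hgi : |(gradient φ x) i| ≤ ‖gradient φ x‖ := PiLp.norm_apply_le (gradient φ x) i
        have h3 : |(gradient φ x) i * x i| ≤ ‖gradient φ x‖ * R := by
          rw [abs_mul]
          gcongr
        have h4 : ((gradient φ x) i * x i) ^ 2 ≤ (‖gradient φ x‖ * R) ^ 2 :=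
          sq_le_sq.2 (h3.trans (le_abs_self _))
        nlinarith [sq_nonneg (φ x + 2 * ((gradient φ x) i * x i))]
    rw [integral_add (hi1.const_mul _) (hi2.const_mul _), integral_const_mul,
      integral_const_mul] at h1
    rw [← key] at h1
    linarith
  rw [← ENNReal.pow_le_pow_left_iff two_ne_zero, mul_pow, sq_eLpNorm_two, sq_eLpNorm_two,
    ← ENNReal.ofReal_pow (by positivity)]
  have c1 : ∫⁻ x in tsupport φ, ‖φ x‖ₑ ^ 2 = ENNReal.ofReal (∫ x in tsupport φ, φ x ^ 2) := by
    rw [ofReal_integral_eq_lintegral_ofReal hi1 (Eventually.of_forall fun x => sq_nonneg _)]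
    refine lintegral_congr fun x => ?_
    rw [← ofReal_norm, ← ENNReal.ofReal_pow (norm_nonneg _), Real.norm_eq_abs, sq_abs]
  have c2 : ∫⁻ x in tsupport φ, ‖gradient φ x‖ₑ ^ 2 =
      ENNReal.ofReal (∫ x in tsupport φ, ‖gradient φ x‖ ^ 2) := by
    rw [ofReal_integral_eq_lintegral_ofReal hi2 (Eventually.of_forall fun x => sq_nonneg _)]
    refine lintegral_congr fun x => ?_
    rw [← ofReal_norm, ← ENNReal.ofReal_pow (norm_nonneg _)]
  rw [c1, c2, ← ENNReal.ofReal_mul (by positivity)]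
  exact ENNReal.ofReal_le_ofReal hineq

/-- Poincaré's inequality for functions in `H¹` with compact support. -/
theorem IsH1LocGradient.eLpNorm_le (hN : 0 < N) {R : ℝ} (hR : 0 ≤ R)
    (hΩ : ∀ x ∈ Ω, ‖x‖ ≤ R) (H : IsH1LocGradient Ω w γ)
    {K : Set (EuclideanSpace ℝ (Fin N))} (hK : IsCompact K) (hKΩ : K ⊆ Ω)
    (hw0 : ∀ x, x ∉ K → w x = 0) (hγ0 : ∀ x, x ∉ K → γ x = 0) :
    eLpNorm w 2 (volume.restrict Ω) ≤
      ENNReal.ofReal (2 * R) * eLpNorm γ 2 (volume.restrict Ω) := by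
  obtain ⟨K₁, hK₁, hK₁Ω, hKK₁, φ, hφs, -, hL2, hgrad, -⟩ :=
    H.exists_testFunction_tendsto hK hKΩ hw0 hγ0
  have hwm : AEStronglyMeasurable w (volume.restrict Ω) := by
    exact H.isWeakGradient.locallyIntegrableOn_fun.aestronglyMeasurable
  have hγm : AEStronglyMeasurable γ (volume.restrict Ω) :=
    H.isWeakGradient.locallyIntegrableOn_grad.aestronglyMeasurable
  have hb : Tendsto (fun n => eLpNorm (fun x => φ n x - w x) 2 (volume.restrict Ω) +
      ENNReal.ofReal (2 * R) * (eLpNorm (fun x => gradient (φ n) x - γ x) 2 (volume.restrict Ω) +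
        eLpNorm γ 2 (volume.restrict Ω))) atTop
      (𝓝 (0 + ENNReal.ofReal (2 * R) * (0 + eLpNorm γ 2 (volume.restrict Ω)))) :=
    hL2.add (ENNReal.Tendsto.const_mul (hgrad.add_const _) (Or.inr ENNReal.ofReal_ne_top))
  rw [zero_add, zero_add] at hb
  refine ge_of_tendsto hb (Eventually.of_forall fun n => ?_)
  have hφm : AEStronglyMeasurable (φ n) (volume.restrict (Ω : Set (EuclideanSpace ℝ (Fin N)))) :=
    (φ n).continuous.aestronglyMeasurable
  have hgm : AEStronglyMeasurable (gradient (φ n))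
      (volume.restrict (Ω : Set (EuclideanSpace ℝ (Fin N)))) :=
    (φ n).contDiff_one.continuous_gradient.aestronglyMeasurable
  have e1 : w = (φ n : EuclideanSpace ℝ (Fin N) → ℝ) - fun x => φ n x - w x := by
    ext x
    simp
  have e2 : gradient (φ n) = (fun x => gradient (φ n) x - γ x) + γ := by
    ext x
    simp
  calc eLpNorm w 2 (volume.restrict Ω)
      ≤ eLpNorm (φ n) 2 (volume.restrict Ω) +
        eLpNorm (fun x => φ n x - w x) 2 (volume.restrict Ω) := by
        conv_lhs => rw [e1]
        exact eLpNorm_sub_le hφm (hφm.sub hwm) one_le_two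
    _ ≤ ENNReal.ofReal (2 * R) * eLpNorm (gradient (φ n)) 2 (volume.restrict Ω) +
        eLpNorm (fun x => φ n x - w x) 2 (volume.restrict Ω) := by
        gcongr
        exact (φ n).eLpNorm_le hN hR hΩ
    _ ≤ _ := by
        rw [add_comm]
        gcongr
        conv_lhs => rw [e2]
        exact eLpNorm_add_le (hgm.sub hγm) hγm one_le_two

end CompactSupport

/-! ### Calculus in `H¹₀` and invariance under null sets. -/

section ZeroTrace

variable {N : ℕ} {Ω : Opens (EuclideanSpace ℝ (Fin N))} {u v w : EuclideanSpace ℝ (Fin N) → ℝ}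
  {g γ : EuclideanSpace ℝ (Fin N) → EuclideanSpace ℝ (Fin N)}

/-- `(u, g)` is approximated in `L²(Ω)` by test functions and their gradients. -/
def IsTestLimit (Ω : Opens (EuclideanSpace ℝ (Fin N))) (u : EuclideanSpace ℝ (Fin N) → ℝ)
    (g : EuclideanSpace ℝ (Fin N) → EuclideanSpace ℝ (Fin N)) : Prop :=
  ∀ ε : ENNReal, 0 < ε → ∃ φ : TestFunction Ω ℝ ⊤,
    eLpNorm (fun x => φ x - u x) 2 (volume.restrict Ω) ≤ ε ∧
    eLpNorm (fun x => gradient φ x - g x) 2 (volume.restrict Ω) ≤ ε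

theorem IsTestLimit.exists_seq (h : IsTestLimit Ω u g) :
    ∃ φ : ℕ → TestFunction Ω ℝ ⊤,
      Tendsto (fun n => eLpNorm (fun x => φ n x - u x) 2 (volume.restrict Ω)) atTop (𝓝 0) ∧
      Tendsto (fun n => eLpNorm (fun x => gradient (φ n) x - g x) 2 (volume.restrict Ω))
        atTop (𝓝 0) := by
  have hpos : ∀ n : ℕ, (0 : ENNReal) < ((n : ENNReal) + 1)⁻¹ := fun n =>
    ENNReal.inv_pos.2 (by finiteness)
  choose φ h1 h2 using fun n : ℕ => h _ (hpos n)
  have hz : Tendsto (fun n : ℕ => ((n : ENNReal) + 1)⁻¹) atTop (𝓝 0) := by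
    have := (tendsto_add_atTop_iff_nat 1).2 ENNReal.tendsto_inv_nat_nhds_zero
    simpa using this
  exact ⟨φ, tendsto_of_tendsto_of_tendsto_of_le_of_le tendsto_const_nhds hz (fun _ => zero_le) h1,
    tendsto_of_tendsto_of_tendsto_of_le_of_le tendsto_const_nhds hz (fun _ => zero_le) h2⟩

theorem isTestLimit_of_tendsto_testFunction {φ : ℕ → TestFunction Ω ℝ ⊤}
    (h1 : Tendsto (fun n => eLpNorm (fun x => φ n x - u x) 2 (volume.restrict Ω)) atTop (𝓝 0))
    (h2 : Tendsto (fun n => eLpNorm (fun x => gradient (φ n) x - g x) 2 (volume.restrict Ω))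
      atTop (𝓝 0)) : IsTestLimit Ω u g := by
  intro ε hε
  obtain ⟨n, hn1, hn2⟩ := ((ENNReal.tendsto_nhds_zero.1 h1 ε hε).and
    (ENNReal.tendsto_nhds_zero.1 h2 ε hε)).exists
  exact ⟨φ n, hn1, hn2⟩

theorem IsTestLimit.of_tendsto {w : ℕ → EuclideanSpace ℝ (Fin N) → ℝ}
    {γ : ℕ → EuclideanSpace ℝ (Fin N) → EuclideanSpace ℝ (Fin N)}
    (h : ∀ n, IsTestLimit Ω (w n) (γ n))
    (hw : ∀ n, AEStronglyMeasurable (w n) (volume.restrict Ω))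
    (hγ : ∀ n, AEStronglyMeasurable (γ n) (volume.restrict Ω))
    (hu : AEStronglyMeasurable u (volume.restrict Ω))
    (hg : AEStronglyMeasurable g (volume.restrict Ω))
    (h1 : Tendsto (fun n => eLpNorm (fun x => w n x - u x) 2 (volume.restrict Ω)) atTop (𝓝 0))
    (h2 : Tendsto (fun n => eLpNorm (fun x => γ n x - g x) 2 (volume.restrict Ω))
      atTop (𝓝 0)) : IsTestLimit Ω u g := by
  intro ε hε
  have hε2 : 0 < ε / 2 := ENNReal.half_pos hε.ne'
  obtain ⟨n, hn1, hn2⟩ := ((ENNReal.tendsto_nhds_zero.1 h1 _ hε2).and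
    (ENNReal.tendsto_nhds_zero.1 h2 _ hε2)).exists
  obtain ⟨φ, hφ1, hφ2⟩ := h n _ hε2
  have tri : ∀ {G : Type} [NormedAddCommGroup G] {a b c : EuclideanSpace ℝ (Fin N) → G},
      AEStronglyMeasurable a (volume.restrict Ω) → AEStronglyMeasurable b (volume.restrict Ω) →
      AEStronglyMeasurable c (volume.restrict Ω) →
      eLpNorm (fun x => a x - b x) 2 (volume.restrict Ω) ≤ ε / 2 →
      eLpNorm (fun x => b x - c x) 2 (volume.restrict Ω) ≤ ε / 2 →
      eLpNorm (fun x => a x - c x) 2 (volume.restrict Ω) ≤ ε := by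
    intro G _ a b c ha hb hc hab hbc
    have e : (fun x => a x - c x) = (fun x => a x - b x) + fun x => b x - c x := by
      ext x
      simp
    rw [e, ← ENNReal.add_halves ε]
    exact (eLpNorm_add_le (ha.sub hb) (hb.sub hc) one_le_two).trans (add_le_add hab hbc)
  exact ⟨φ, tri φ.continuous.aestronglyMeasurable (hw n) hu hφ1 hn1,
    tri φ.contDiff_one.continuous_gradient.aestronglyMeasurable (hγ n) hg hφ2 hn2⟩

theorem TestFunction.isH1LocGradient (φ : TestFunction Ω ℝ ⊤) :
    IsH1LocGradient Ω φ (gradient φ) :=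
  ⟨⟨φ.continuous.locallyIntegrable.locallyIntegrableOn _,
    φ.contDiff_one.continuous_gradient.locallyIntegrable.locallyIntegrableOn _,
    integral_mul_gradient_of_contDiff φ.contDiff_one⟩,
    fun _ hK _ => φ.continuous.memLp_restrict_isCompact hK,
    fun _ hK _ => φ.contDiff_one.continuous_gradient.memLp_restrict_isCompact hK⟩

theorem IsWeakGradient.isH1LocGradient (h : IsWeakGradient Ω u g)
    (hu : MemLp u 2 (volume.restrict Ω)) (hg : MemLp g 2 (volume.restrict Ω)) :
    IsH1LocGradient Ω u g :=
  ⟨h, fun _ _ hKΩ => hu.mono_measure (Measure.restrict_mono_set _ hKΩ),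
    fun _ _ hKΩ => hg.mono_measure (Measure.restrict_mono_set _ hKΩ)⟩

/-- `H¹₀` is stable under composition with a Lipschitz function vanishing at the origin which has
a right derivative at each point. -/
theorem MemH10.comp (hΩ : Bornology.IsBounded (Ω : Set (EuclideanSpace ℝ (Fin N))))
    (hu : MemH10 Ω u) {F h : ℝ → ℝ} {C : ℝ≥0} (hF : LipschitzWith C F) (hF0 : F 0 = 0)
    (hh : ∀ s, HasDerivWithinAt F (h s) (Set.Ici s) s) : MemH10 Ω (fun x => F (u x)) := by
  obtain ⟨g, hwg, hu2, hg2, φ, hφ1, hφ2⟩ := hu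
  have hfin : IsFiniteMeasure (volume.restrict (Ω : Set (EuclideanSpace ℝ (Fin N)))) :=
    ⟨by simpa using hΩ.measure_lt_top⟩
  have H := hwg.isH1LocGradient hu2 hg2
  have hFc := hF.continuous
  have hmeas := measurable_of_hasDerivWithinAt_Ici hFc hh
  have hbd : ∀ s, |h s| ≤ C := fun s => hF.abs_le_of_hasDerivWithinAt (hh s)
  have hFu : MemLp (fun x => F (u x)) 2 (volume.restrict Ω) :=
    hu2.of_le_mul (c := C) (hFc.comp_aestronglyMeasurable hu2.1)
      (Eventually.of_forall fun x => by simpa [hF0] using hF.norm_sub_le (u x) 0)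
  have hθ : AEStronglyMeasurable (fun x => h (u x)) (volume.restrict Ω) :=
    (hmeas.comp_aemeasurable hu2.1.aemeasurable).aestronglyMeasurable
  have hgu : MemLp (fun x => h (u x) • g x) 2 (volume.restrict Ω) :=
    hg2.bdd_smul hθ (Eventually.of_forall fun x => hbd _)
  -- The averages are normalized to vanish at `0`, so that `A k (φ n x)` keeps compact support. For
  -- fixed `k` the limit in `n` uses continuity of `a k`; then `k → ∞`.
  set A : ℕ → ℝ → ℝ := fun k s => forwardAverage F k s - forwardAverage F k 0 with hA
  set a : ℕ → ℝ → ℝ := fun k s => ((k : ℝ) + 1) * (F (s + 1 / ((k : ℝ) + 1)) - F s) with ha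
  have hAd : ∀ k s, HasDerivAt (A k) (a k s) s := fun k s =>
    (hasDerivAt_forwardAverage hFc k s).sub_const _
  have hac : ∀ k, Continuous (a k) := fun k => by simp only [ha]; fun_prop
  have hab : ∀ k s, |a k s| ≤ C := fun k s => hF.forwardAverage_deriv_le k s
  have hAL : ∀ k, LipschitzWith C (A k) := fun k =>
    lipschitzWith_of_nnnorm_deriv_le (fun s => (hAd k s).differentiableAt) fun s => by
      rw [(hAd k s).deriv]
      exact hab k s
  have hAc : ∀ k, Continuous (A k) := fun k => (hAL k).continuous
  have hφm : ∀ n, AEStronglyMeasurable (φ n) (volume.restrict (Ω : Set _)) := fun n =>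
    (φ n).continuous.aestronglyMeasurable
  have hgm : ∀ n, AEStronglyMeasurable (gradient (φ n)) (volume.restrict (Ω : Set _)) := fun n =>
    (φ n).contDiff_one.continuous_gradient.aestronglyMeasurable
  have isTestLimit_testFunction : ∀ k n, IsTestLimit Ω (fun x => A k (φ n x))
      (fun x => a k (φ n x) • gradient (φ n) x) := by
    intro k n
    have H' := (φ n).isH1LocGradient.comp_of_continuous_deriv (hAL k) (hAd k) (hac k)
    obtain ⟨-, -, -, -, ψ, -, -, h1, h2, -⟩ := H'.exists_testFunction_tendsto
      (φ n).hasCompactSupport.isCompact (φ n).tsupport_subset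
      (fun x hx => by simp [image_eq_zero_of_notMem_tsupport hx, hA])
      (fun x hx => by simp [gradient_eq_zero_of_notMem_tsupport hx])
    exact isTestLimit_of_tendsto_testFunction h1 h2
  -- An almost everywhere convergent subsequence makes `a k (φ (ns n) x)` converge to `a k (u x)`.
  obtain ⟨ns, hns, hae⟩ := exists_subseq_tendsto_ae hφm hu2.1 hφ1
  have isTestLimit_average : ∀ k, IsTestLimit Ω (fun x => A k (u x)) (fun x => a k (u x) • g x) := by
    intro k
    refine IsTestLimit.of_tendsto (fun n => isTestLimit_testFunction k (ns n))
      (fun n => (hAc k).comp_aestronglyMeasurable (hφm _))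
      (fun n => ((hac k).comp_aestronglyMeasurable (hφm _)).smul (hgm _))
      ((hAc k).comp_aestronglyMeasurable hu2.1)
      (((hac k).comp_aestronglyMeasurable hu2.1).smul hg2.1) ?_ ?_
    · have hb : Tendsto (fun n => ENNReal.ofReal C * eLpNorm
          (fun x => φ (ns n) x - u x) 2 (volume.restrict Ω)) atTop (𝓝 0) := by
        simpa using ENNReal.Tendsto.const_mul (a := ENNReal.ofReal C)
          (hφ1.comp hns.tendsto_atTop) (Or.inr ENNReal.ofReal_ne_top)
      refine tendsto_of_tendsto_of_tendsto_of_le_of_le tendsto_const_nhds hb (fun _ => zero_le)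
        (fun n => eLpNorm_le_mul_eLpNorm_of_ae_le_mul (Eventually.of_forall fun x => ?_) 2)
      exact (hAL k).norm_sub_le _ _
    · exact tendsto_eLpNorm_smul_sub (C := C)
        (fun n => (hac k).comp_aestronglyMeasurable (hφm _))
        ((hac k).comp_aestronglyMeasurable hu2.1)
        (fun n => Eventually.of_forall fun x => hab k _)
        (hae.mono fun x hx => ((hac k).tendsto _).comp hx)
        (fun n => hgm _) hg2 (hφ2.comp hns.tendsto_atTop)
  have isTestLimit_comp : IsTestLimit Ω (fun x => F (u x)) (fun x => h (u x) • g x) := by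
    refine IsTestLimit.of_tendsto isTestLimit_average (fun k => (hAc k).comp_aestronglyMeasurable hu2.1)
      (fun k => ((hac k).comp_aestronglyMeasurable hu2.1).smul hg2.1) hFu.1 hgu.1 ?_ ?_
    · have hAF : ∀ (k : ℕ) s, |A k s - F s| ≤ 2 * C * (1 / ((k : ℝ) + 1)) := by
        intro k s
        have h1 := hF.abs_forwardAverage_sub_le k s
        have h2 := hF.abs_forwardAverage_sub_le k 0
        rw [hF0, sub_zero] at h2
        have h3 := abs_sub (forwardAverage F k s - F s) (forwardAverage F k 0)
        have e : A k s - F s = forwardAverage F k s - F s - forwardAverage F k 0 := by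
          simp only [hA]
          ring
        rw [e]
        linarith
      refine tendsto_eLpNorm_two_of_dominated (b := fun _ => 2 * (C : ℝ))
        (fun k => ((hAc k).comp_aestronglyMeasurable hu2.1).sub hFu.1)
        (memLp_const _) (fun k => Eventually.of_forall fun x => ?_)
        (Eventually.of_forall fun x => ?_)
      · refine (hAF k (u x)).trans (mul_le_of_le_one_right (by positivity) ?_)
        rw [div_le_one (by positivity)]
        linarith [(Nat.cast_nonneg k : (0 : ℝ) ≤ k)]
      · have hz : Tendsto (fun k : ℕ => 2 * (C : ℝ) * (1 / ((k : ℝ) + 1))) atTop (𝓝 0) := by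
          simpa using tendsto_one_div_add_atTop_nhds_zero_nat.const_mul (2 * (C : ℝ))
        exact squeeze_zero_norm (fun k => hAF k (u x)) hz
    · exact tendsto_eLpNorm_smul_sub (C := C) (γ := fun _ => g)
        (fun k => (hac k).comp_aestronglyMeasurable hu2.1) hθ
        (fun k => Eventually.of_forall fun x => hab k _)
        (Eventually.of_forall fun x => tendsto_forwardAverage_deriv (hh (u x)))
        (fun _ => hg2.1) hg2 (by simp)
  exact ⟨_, (H.comp hF hh).isWeakGradient, hFu, hgu, isTestLimit_comp.exists_seq⟩

theorem IsWeakGradient.congr (h : IsWeakGradient Ω u g) (huv : v =ᵐ[volume.restrict Ω] u) :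
    IsWeakGradient Ω v g := by
  refine ⟨?_, h.locallyIntegrableOn_grad, fun φ i => ?_⟩
  · rw [locallyIntegrableOn_iff Ω.isOpen.isLocallyClosed]
    exact fun K hKs hK => (h.locallyIntegrableOn_fun.integrableOn_compact_subset hKs hK).congr
      (ae_restrict_of_ae_restrict_of_subset hKs huv.symm)
  · rw [← h.integral_eq φ i]
    refine integral_congr_ae ?_
    filter_upwards [huv] with x hx
    rw [hx]

theorem MemH1Loc.congr (h : MemH1Loc Ω u) (huv : v =ᵐ[volume.restrict Ω] u) : MemH1Loc Ω v := by
  obtain ⟨g, hg, hK⟩ := h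
  exact ⟨g, hg.congr huv, fun K hKc hKs =>
    ⟨(memLp_congr_ae (ae_restrict_of_ae_restrict_of_subset hKs huv)).2 (hK K hKc hKs).1,
      (hK K hKc hKs).2⟩⟩

theorem MemH10.congr (h : MemH10 Ω u) (huv : v =ᵐ[volume.restrict Ω] u) : MemH10 Ω v := by
  obtain ⟨g, hg, hu2, hg2, φ, hφ1, hφ2⟩ := h
  refine ⟨g, hg.congr huv, (memLp_congr_ae huv).2 hu2, hg2, φ, hφ1.congr fun n => ?_, hφ2⟩
  refine eLpNorm_congr_ae ?_
  filter_upwards [huv] with x hx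
  rw [hx]

theorem InBoccardoOrsinaClass.congr {β : ℝ} (h : InBoccardoOrsinaClass Ω β u)
    (huv : v =ᵐ[volume.restrict Ω] u) : InBoccardoOrsinaClass Ω β v :=
  ⟨h.1.congr huv, h.2.congr (huv.mono fun x hx => by simp only [hx])⟩

theorem IsSingularSolution.congr {β : ℝ} {f : EuclideanSpace ℝ (Fin N) → ℝ}
    (h : IsSingularSolution Ω β f u) (huv : v =ᵐ[volume.restrict Ω] u) :
    IsSingularSolution Ω β f v := by
  refine ⟨h.memH1Loc.congr huv, fun K hK hKs => ?_, ?_⟩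
  · obtain ⟨c, hc, hcu⟩ := h.pos K hK hKs
    refine ⟨c, hc, ?_⟩
    filter_upwards [hcu, ae_restrict_of_ae_restrict_of_subset hKs huv] with x hx hx'
    rwa [hx']
  · obtain ⟨g, hg, hw⟩ := h.weak
    refine ⟨g, hg.congr huv, fun φ => (hw φ).trans (integral_congr_ae ?_)⟩
    filter_upwards [huv] with x hx
    rw [hx]

/-- The exceptional set depends on the compact set, so `Ω` is exhausted by countably many compacts.
-/
theorem IsPositiveIn.ae_pos (h : IsPositiveIn Ω u) : ∀ᵐ x ∂(volume.restrict Ω), 0 < u x := by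
  have : LocallyCompactSpace Ω := Ω.isOpen.locallyCompactSpace
  let K := CompactExhaustion.choice Ω
  have hcover : (Ω : Set (EuclideanSpace ℝ (Fin N))) = ⋃ n, Subtype.val '' K n := by
    rw [← Set.image_iUnion, K.iUnion_eq, Set.image_univ, Subtype.range_coe]
  rw [hcover, ae_restrict_iUnion_iff]
  intro n
  obtain ⟨c, hc, hcu⟩ := h (Subtype.val '' K n) ((K.isCompact n).image continuous_subtype_val)
    (by rintro _ ⟨y, -, rfl⟩; exact y.2)
  filter_upwards [hcu] with x hx using hc.trans_le hx

end ZeroTrace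

/-! ### One-variable truncations and powers. -/

section Truncations

theorem lipschitzWith_of_hasDerivWithinAt_Ici {F h : ℝ → ℝ} {C : ℝ≥0} (hF : Continuous F)
    (hh : ∀ s, HasDerivWithinAt F (h s) (Set.Ici s) s) (hC : ∀ s, |h s| ≤ C) :
    LipschitzWith C F := by
  have key : ∀ a b, a ≤ b → |F b - F a| ≤ C * (b - a) := fun a b hab =>
    norm_image_sub_le_of_norm_deriv_right_le_segment hF.continuousOn (fun x _ => hh x)
      (fun x _ => hC x) b (Set.right_mem_Icc.2 hab)
  refine LipschitzWith.of_dist_le_mul fun x y => ?_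
  rw [Real.dist_eq, Real.dist_eq]
  rcases le_total x y with h | h
  · rw [abs_sub_comm, abs_sub_comm x y, abs_of_nonneg (sub_nonneg.2 h)]
    exact key x y h
  · rw [abs_of_nonneg (sub_nonneg.2 h)]
    exact key y x h

/-- At the kink `s = d` the right derivative belongs to the branch `d ≤ t`, hence the non-strict
condition. -/
theorem hasDerivWithinAt_comp_max {F h : ℝ → ℝ} {d : ℝ}
    (hF : ∀ s, d ≤ s → HasDerivWithinAt F (h s) (Set.Ici s) s) (s : ℝ) :
    HasDerivWithinAt (fun t => F (max t d)) (if d ≤ s then h s else 0) (Set.Ici s) s := by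
  split_ifs with hs
  · refine (hF s hs).congr (fun t ht => ?_) ?_
    · rw [max_eq_left (hs.trans ht)]
    · rw [max_eq_left hs]
  · push Not at hs
    refine (hasDerivWithinAt_const s (Set.Ici s) (F d)).congr_of_eventuallyEq ?_ ?_
    · filter_upwards [mem_nhdsWithin_of_mem_nhds (Iio_mem_nhds hs)] with t ht
      rw [max_eq_right (le_of_lt ht)]
    · rw [max_eq_right hs.le]

theorem hasDerivWithinAt_max (d s : ℝ) :
    HasDerivWithinAt (fun t => max t d) (if d ≤ s then 1 else 0) (Set.Ici s) s :=
  hasDerivWithinAt_comp_max (F := fun t => t) (h := fun _ => 1)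
    (fun s _ => hasDerivWithinAt_id s _) s

theorem lipschitzWith_max_const (d : ℝ) : LipschitzWith 1 fun t => max t d :=
  lipschitzWith_of_hasDerivWithinAt_Ici (by fun_prop) (hasDerivWithinAt_max d) fun s => by
    split_ifs <;> simp

theorem hasDerivWithinAt_max_rpow {d : ℝ} (hd : 0 < d) (r s : ℝ) :
    HasDerivWithinAt (fun t => max t d ^ r) (if d ≤ s then r * s ^ (r - 1) else 0)
      (Set.Ici s) s :=
  hasDerivWithinAt_comp_max (F := fun t => t ^ r) (h := fun s => r * s ^ (r - 1))
    (fun _ hs => (Real.hasDerivAt_rpow_const (Or.inl (hd.trans_le hs).ne')).hasDerivWithinAt) s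

theorem continuous_max_rpow {d : ℝ} (hd : 0 < d) (r : ℝ) : Continuous fun t => max t d ^ r :=
  (continuous_id.max continuous_const).rpow_const fun _ => Or.inl (lt_max_of_lt_right hd).ne'

/-- For `r ≤ 1` the factor `s ^ (r - 1)` does not increase in `s`, so on `s ≥ d` it is largest at
`d`. -/
theorem exists_lipschitzWith_max_rpow {d r : ℝ} (hd : 0 < d) (hr : r ≤ 1) :
    ∃ C, LipschitzWith C fun t => max t d ^ r := by
  refine ⟨(|r| * d ^ (r - 1)).toNNReal, lipschitzWith_of_hasDerivWithinAt_Ici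
    (continuous_max_rpow hd r) (hasDerivWithinAt_max_rpow hd r) fun s =>
      le_trans ?_ (Real.le_coe_toNNReal _)⟩
  split_ifs with hs
  · rw [abs_mul, abs_of_nonneg (Real.rpow_nonneg (hd.le.trans hs) _)]
    exact mul_le_mul_of_nonneg_left
      (Real.rpow_le_rpow_of_nonpos hd hs (by linarith)) (abs_nonneg _)
  · rw [abs_zero]
    positivity

/-- The derivative of the truncated power `s ↦ (min s⁺ M) ^ p`. -/
noncomputable def truncPowDeriv (p M s : ℝ) : ℝ := if 0 ≤ s ∧ s < M then p * s ^ (p - 1) else 0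

theorem hasDerivWithinAt_min_max_rpow {p M : ℝ} (hp : 1 < p) (s : ℝ) :
    HasDerivWithinAt (fun t => min (max t 0) M ^ p) (truncPowDeriv p M s) (Set.Ici s) s := by
  have e : truncPowDeriv p M s =
      if 0 ≤ s then (if s < M then p * s ^ (p - 1) else 0) else 0 := by
    unfold truncPowDeriv
    split_ifs <;> simp_all
  rw [e]
  refine hasDerivWithinAt_comp_max (F := fun t => min t M ^ p)
    (h := fun s => if s < M then p * s ^ (p - 1) else 0) (fun s hs => ?_) s
  split_ifs with hsM
  · have h1 : HasDerivWithinAt (fun t : ℝ => t ^ p) (p * s ^ (p - 1)) (Set.Ici s) s :=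
      (Real.hasDerivAt_rpow_const (Or.inr hp.le)).hasDerivWithinAt
    refine h1.congr_of_eventuallyEq ?_ ?_
    · filter_upwards [mem_nhdsWithin_of_mem_nhds (Iio_mem_nhds hsM)] with t ht
      rw [min_eq_left (le_of_lt ht)]
    · rw [min_eq_left hsM.le]
  · push Not at hsM
    refine (hasDerivWithinAt_const s (Set.Ici s) (M ^ p)).congr (fun t ht => ?_) ?_
    · rw [min_eq_right (hsM.trans ht)]
    · rw [min_eq_right hsM]

theorem exists_lipschitzWith_min_max_rpow {p M : ℝ} (hp : 1 < p) (hM : 0 < M) :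
    ∃ C, LipschitzWith C fun t => min (max t 0) M ^ p := by
  refine ⟨(p * M ^ (p - 1)).toNNReal, lipschitzWith_of_hasDerivWithinAt_Ici
    (((continuous_id.max continuous_const).min continuous_const).rpow_const
      fun t => Or.inr (by linarith)) (hasDerivWithinAt_min_max_rpow hp) fun s =>
      le_trans ?_ (Real.le_coe_toNNReal _)⟩
  rw [truncPowDeriv]
  split_ifs with hs
  · rw [abs_of_nonneg (by have := hs.1; positivity)]
    exact mul_le_mul_of_nonneg_left (Real.rpow_le_rpow hs.1 hs.2.le (by linarith)) (by linarith)
  · rw [abs_zero]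
    positivity

end Truncations

/-! ### Boundary values, and gradients of solutions. -/

section Solutions

variable {N : ℕ} {Ω : Opens (EuclideanSpace ℝ (Fin N))} {u v : EuclideanSpace ℝ (Fin N) → ℝ}
  {g G : EuclideanSpace ℝ (Fin N) → EuclideanSpace ℝ (Fin N)}

theorem max_rpow_rpow_inv {q s c : ℝ} (hq : 0 < q) (hs : 0 ≤ s) (hc : 0 ≤ c) :
    max (s ^ q) (c ^ q) ^ (1 / q) = max s c := by
  have e : max (s ^ q) (c ^ q) = max s c ^ q := by
    rcases le_total s c with h | h
    · rw [max_eq_right h, max_eq_right (Real.rpow_le_rpow hs h hq.le)]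
    · rw [max_eq_left h, max_eq_left (Real.rpow_le_rpow hc h hq.le)]
  rw [e, one_div, Real.rpow_rpow_inv (le_max_of_le_left hs) hq.ne']

theorem memH10_sub_pos_part (hΩ : Bornology.IsBounded (Ω : Set (EuclideanSpace ℝ (Fin N))))
    {q ε : ℝ} (hq : 1 ≤ q) (hε : 0 < ε) (hu0 : ∀ᵐ x ∂(volume.restrict Ω), 0 ≤ u x)
    (hu : MemH10 Ω fun x => u x ^ q) : MemH10 Ω fun x => max (u x - ε) 0 := by
  have hq0 : 0 < q := by linarith
  have hd : 0 < ε ^ q := by positivity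
  obtain ⟨C, hC⟩ := exists_lipschitzWith_max_rpow hd (r := 1 / q)
    ((div_le_one hq0).2 hq)
  have hL : LipschitzWith C fun t => max t (ε ^ q) ^ (1 / q) - ε :=
    LipschitzWith.of_dist_le_mul fun x y => by simpa using hC.dist_le_mul x y
  refine (hu.comp hΩ hL ?_ fun s => (hasDerivWithinAt_max_rpow hd _ s).sub_const _).congr ?_
  · have := max_rpow_rpow_inv hq0 le_rfl hε.le
    rw [Real.zero_rpow hq0.ne'] at this
    rw [this, max_eq_right hε.le, sub_self]
  · filter_upwards [hu0] with x hx
    rw [max_rpow_rpow_inv hq0 hx hε.le, ← max_sub_sub_right, sub_self]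

theorem InBoccardoOrsinaClass.vanishesOnBoundary {β : ℝ}
    (hΩ : Bornology.IsBounded (Ω : Set (EuclideanSpace ℝ (Fin N))))
    (hu0 : ∀ᵐ x ∂(volume.restrict Ω), 0 ≤ u x) (hu : InBoccardoOrsinaClass Ω β u) :
    VanishesOnBoundary Ω u :=
  ⟨hu0, fun _ hε => memH10_sub_pos_part hΩ (le_max_left _ _) hε hu0 hu.2⟩

theorem IsSingularSolution.exists_gradient {β : ℝ} {f : EuclideanSpace ℝ (Fin N) → ℝ}
    (h : IsSingularSolution Ω β f u) : ∃ g, IsH1LocGradient Ω u g ∧ ∀ φ : TestFunction Ω ℝ 1,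
      ∫ x in (Ω : Set (EuclideanSpace ℝ (Fin N))), inner ℝ (g x) (gradient φ x) =
        ∫ x in (Ω : Set (EuclideanSpace ℝ (Fin N))), f x / u x ^ β * φ x := by
  obtain ⟨g, hg, hw⟩ := h.weak
  obtain ⟨g', hg', hK⟩ := h.memH1Loc
  refine ⟨g, ⟨hg, fun K hKc hKs => (hK K hKc hKs).1, fun K hKc hKs => ?_⟩, hw⟩
  exact (memLp_congr_ae (ae_restrict_of_ae_restrict_of_subset hKs (hg.ae_eq hg'))).2
    (hK K hKc hKs).2

/-- Where `u ≥ c` the right side is at most `c ^ (-β)` times `|f|`. -/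
theorem IsSingularSolution.locallyIntegrableOn {β : ℝ} (hβ : 0 ≤ β)
    {f : EuclideanSpace ℝ (Fin N) → ℝ} (hf : IntegrableOn f Ω)
    (h : IsSingularSolution Ω β f u) : LocallyIntegrableOn (fun x => f x / u x ^ β) Ω := by
  rw [locallyIntegrableOn_iff Ω.isOpen.isLocallyClosed]
  intro K hKs hK
  obtain ⟨c, hc, hcu⟩ := h.pos K hK hKs
  obtain ⟨g, -, hg⟩ := h.memH1Loc
  have hum : AEMeasurable u (volume.restrict K) := (hg K hK hKs).1.1.aemeasurable
  refine ((hf.mono_set hKs).norm.const_mul (c ^ β)⁻¹).mono'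
    ((hf.mono_set hKs).1.aemeasurable.div (hum.pow_const β)).aestronglyMeasurable ?_
  filter_upwards [hcu] with x hx
  rw [norm_div, div_eq_inv_mul, Real.norm_of_nonneg (Real.rpow_nonneg (hc.le.trans hx) _)]
  gcongr

/-- The weak gradients of `u > 0` and `u ^ q` are related by the chain rule. -/
theorem ae_gradient_eq_of_rpow {q : ℝ} (hq : 1 ≤ q) (hu0 : ∀ᵐ x ∂(volume.restrict Ω), 0 < u x)
    (hu : IsH1LocGradient Ω u g) (hU : IsH1LocGradient Ω (fun x => u x ^ q) G) :
    ∀ᵐ x ∂(volume.restrict Ω), g x = (1 / q * (u x ^ q) ^ (1 / q - 1)) • G x := by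
  have hq0 : 0 < q := by linarith
  -- The power `1 / q` is Lipschitz only away from `0`. So `max (u x) c` is differentiated in two
  -- ways, from `u` and from `u ^ q`, and uniqueness of weak gradients compares the results on `{c ≤
  -- u}`; these sets exhaust `{0 < u}`.
  have key : ∀ n : ℕ, ∀ᵐ x ∂(volume.restrict Ω), 1 / ((n : ℝ) + 1) ≤ u x →
      g x = (1 / q * (u x ^ q) ^ (1 / q - 1)) • G x := by
    intro n
    set c : ℝ := 1 / ((n : ℝ) + 1) with hc
    have hc0 : 0 < c := by positivity
    obtain ⟨C, hC⟩ := exists_lipschitzWith_max_rpow (by positivity : 0 < c ^ q) (r := 1 / q)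
      ((div_le_one hq0).2 hq)
    have h1 := (hu.comp (lipschitzWith_max_const c) (hasDerivWithinAt_max c)).isWeakGradient
    have h2 := (hU.comp hC (hasDerivWithinAt_max_rpow (by positivity) (1 / q))).isWeakGradient
    have h3 : (fun x => max (u x) c) =ᵐ[volume.restrict Ω]
        fun x => max (u x ^ q) (c ^ q) ^ (1 / q) := by
      filter_upwards [hu0] with x hx
      rw [max_rpow_rpow_inv hq0 hx.le hc0.le]
    filter_upwards [h1.ae_eq (h2.congr h3)] with x hx hcx
    rwa [if_pos hcx, one_smul, if_pos (Real.rpow_le_rpow hc0.le hcx hq0.le)] at hx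
  filter_upwards [ae_all_iff.2 key, hu0] with x hx hx0
  obtain ⟨n, hn⟩ := exists_nat_one_div_lt hx0
  exact hx n hn.le

end Solutions

/-! ### The energy estimate behind the comparison principle. -/

section Comparison

/-- The relative error `(s / t) ^ (1 - 1 / q) - 1`, for `0 < s ≤ t`. -/
noncomputable def powerDefect (q s t : ℝ) : ℝ :=
  if 0 < s ∧ s ≤ t then (s / t) ^ (1 - 1 / q) - 1 else 0

theorem measurable_powerDefect (q : ℝ) :
    Measurable fun p : ℝ × ℝ => powerDefect q p.1 p.2 := by
  unfold powerDefect
  refine Measurable.ite ?_ (by fun_prop) measurable_const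
  exact (measurableSet_lt measurable_const measurable_fst).inter
    (measurableSet_le measurable_fst measurable_snd)

theorem abs_powerDefect_le {q : ℝ} (hq : 1 ≤ q) (s t : ℝ) : |powerDefect q s t| ≤ 1 := by
  unfold powerDefect
  have hq' : 0 ≤ 1 - 1 / q := by
    rw [sub_nonneg, div_le_one (by linarith)]
    exact hq
  split_ifs with h
  · have ht : 0 < t := h.1.trans_le h.2
    have h0 : 0 ≤ s / t := div_nonneg h.1.le ht.le
    have h1 := Real.rpow_le_one h0 ((div_le_one ht).2 h.2) hq'
    have h2 := Real.rpow_nonneg h0 (1 - 1 / q)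
    rw [abs_le]
    constructor <;> linarith
  · simp

theorem tendsto_powerDefect {q t : ℝ} (ht : 0 < t) {s : ℕ → ℝ} (hs : Tendsto s atTop (𝓝 t)) :
    Tendsto (fun n => powerDefect q (s n) t) atTop (𝓝 0) := by
  have h1 : Tendsto (fun n => (s n / t) ^ (1 - 1 / q) - 1) atTop (𝓝 0) := by
    have h := ((hs.div_const t).rpow_const (p := 1 - 1 / q)
      (Or.inl (by rw [div_self ht.ne']; exact one_ne_zero))).sub_const 1
    rwa [div_self ht.ne', Real.one_rpow, sub_self] at h
  refine squeeze_zero_norm (fun n => ?_) (tendsto_norm_zero.comp h1)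
  unfold powerDefect
  split_ifs
  · exact le_rfl
  · simp

section Pointwise

variable {V : Type*} [NormedAddCommGroup V] [InnerProductSpace ℝ V]

/-- This is `‖A + D‖ ^ 2 ≥ 0` rearranged. With `A + D = ∇u - ∇v` the inner product is the tested
quantity, and only the square of the error `D` remains. -/
theorem sq_norm_le_add_inner (A D : V) : ‖A‖ ^ 2 ≤ ‖D‖ ^ 2 + 2 * inner ℝ (A + D) A := by
  have h := sq_nonneg ‖A + D‖
  rw [norm_add_sq_real] at h
  rw [inner_add_left, real_inner_self_eq_norm_sq, real_inner_comm]
  linarith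

/-- With `s = φ`, `t = u ^ q`, `G = ∇(u ^ q)` and `P = ∇φ`, the bracket is `∇u - ∇(φ ^ (1 / q))`.
Its weight cancels the singular power on `∇φ` exactly and leaves `(s / t) ^ (1 - 1 / q)` on `G`. -/
theorem smul_sub_eq_powerDefect {q s t : ℝ} (hq : 0 < q) (hs : 0 < s) (hst : s ≤ t) (G P : V) :
    (q * (s ^ (1 / q)) ^ (q - 1)) • ((1 / q * t ^ (1 / q - 1)) • G -
      (1 / q * s ^ (1 / q - 1)) • P) = powerDefect q s t • G + (G - P) := by
  have ht : 0 < t := hs.trans_le hst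
  have e1 : (s ^ (1 / q)) ^ (q - 1) = s ^ (1 - 1 / q) := by
    rw [← Real.rpow_mul hs.le]
    congr 1
    field_simp
  have e2 : s ^ (1 - 1 / q) * s ^ (1 / q - 1) = 1 := by
    rw [← Real.rpow_add hs]
    simp
  have e3 : s ^ (1 - 1 / q) * t ^ (1 / q - 1) = (s / t) ^ (1 - 1 / q) := by
    rw [Real.div_rpow hs.le ht.le, div_eq_mul_inv (s ^ (1 - 1 / q)), ← Real.rpow_neg ht.le, neg_sub]
  rw [e1, smul_sub, smul_smul, smul_smul, powerDefect, if_pos ⟨hs, hst⟩]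
  have e4 : q * s ^ (1 - 1 / q) * (1 / q * t ^ (1 / q - 1)) = (s / t) ^ (1 - 1 / q) := by
    calc _ = q * (1 / q) * (s ^ (1 - 1 / q) * t ^ (1 / q - 1)) := by ring
      _ = _ := by rw [e3, mul_one_div_cancel hq.ne', one_mul]
  have e5 : q * s ^ (1 - 1 / q) * (1 / q * s ^ (1 / q - 1)) = 1 := by
    calc _ = q * (1 / q) * (s ^ (1 - 1 / q) * s ^ (1 / q - 1)) := by ring
      _ = 1 := by rw [e2, mul_one, mul_one_div_cancel hq.ne']
  rw [e4, e5, sub_smul, one_smul, one_smul]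
  abel

/-- Because `2 (q - 1) = β - 1`, the square of the derivative of `m ^ q` and the derivative of `m ^
β` carry the same power of `m`. The weight on `D` is raised from `m` to `a` using `m ≤ a`. -/
theorem sq_norm_smul_le {q β M m a : ℝ} (hq : 1 < q) (hβ : β = 2 * q - 1) (hm : 0 < m)
    (hmM : m < M) (hma : m ≤ a) {A D g : V} {B : ℝ} (hg : g = A + D)
    (hD : ‖(q * a ^ (q - 1)) • D‖ ≤ B) :
    ‖truncPowDeriv q M m • A‖ ^ 2 ≤
      B ^ 2 + 2 * q ^ 2 / β * inner ℝ g (truncPowDeriv β M m • A) := by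
  have hβ0 : 0 < β := by linarith
  rw [truncPowDeriv, truncPowDeriv, if_pos ⟨hm.le, hmM⟩, if_pos ⟨hm.le, hmM⟩, inner_smul_right,
    norm_smul, mul_pow, Real.norm_eq_abs, sq_abs, mul_pow]
  have hr : (m ^ (q - 1)) ^ 2 = m ^ (β - 1) := by
    rw [← Real.rpow_natCast, ← Real.rpow_mul hm.le]
    congr 1
    push_cast
    linarith
  rw [hr]
  set r := m ^ (β - 1) with hrd
  have hr0 : 0 ≤ r := Real.rpow_nonneg hm.le _
  have hra : r ≤ (a ^ (q - 1)) ^ 2 := by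
    rw [← hr]
    gcongr
  have h1 : q ^ 2 * r * ‖D‖ ^ 2 ≤ B ^ 2 := by
    have h2 : ‖(q * a ^ (q - 1)) • D‖ ^ 2 ≤ B ^ 2 := by gcongr
    rw [norm_smul, mul_pow, Real.norm_eq_abs, sq_abs, mul_pow] at h2
    refine le_trans ?_ h2
    gcongr
  have h3 := sq_norm_le_add_inner A D
  rw [← hg] at h3
  have h4 : q ^ 2 * r * ‖A‖ ^ 2 ≤ q ^ 2 * r * (‖D‖ ^ 2 + 2 * inner ℝ g A) := by gcongr
  have h5 : 2 * q ^ 2 / β * (β * r * inner ℝ g A) = q ^ 2 * r * (2 * inner ℝ g A) := by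
    field_simp
  rw [h5]
  linarith

theorem truncPowDeriv_of_nonpos {p M m : ℝ} (hp : 1 < p) (hm : m ≤ 0) :
    truncPowDeriv p M m = 0 := by
  unfold truncPowDeriv
  split_ifs with h
  · rw [le_antisymm hm h.1, Real.zero_rpow (by linarith), mul_zero]
  · rfl

end Pointwise

theorem eLpNorm_two_le_of_integral_sq_le {α V W : Type*} [MeasurableSpace α] {μ : Measure α}
    [NormedAddCommGroup V] [NormedAddCommGroup W] {a : α → V} {b : α → W} (ha : MemLp a 2 μ)
    (hb : MemLp b 2 μ) (h : ∫ x, ‖a x‖ ^ 2 ∂μ ≤ ∫ x, ‖b x‖ ^ 2 ∂μ) :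
    eLpNorm a 2 μ ≤ eLpNorm b 2 μ := by
  rw [← ENNReal.pow_le_pow_left_iff two_ne_zero, sq_eLpNorm_two, sq_eLpNorm_two]
  have ea : ∫⁻ x, ‖a x‖ₑ ^ 2 ∂μ = ENNReal.ofReal (∫ x, ‖a x‖ ^ 2 ∂μ) := by
    rw [ofReal_integral_eq_lintegral_ofReal ha.norm.integrable_sq
      (Eventually.of_forall fun x => sq_nonneg _)]
    refine lintegral_congr fun x => ?_
    rw [← ofReal_norm, ← ENNReal.ofReal_pow (norm_nonneg _)]
  have eb : ∫⁻ x, ‖b x‖ₑ ^ 2 ∂μ = ENNReal.ofReal (∫ x, ‖b x‖ ^ 2 ∂μ) := by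
    rw [ofReal_integral_eq_lintegral_ofReal hb.norm.integrable_sq
      (Eventually.of_forall fun x => sq_nonneg _)]
    refine lintegral_congr fun x => ?_
    rw [← ofReal_norm, ← ENNReal.ofReal_pow (norm_nonneg _)]
  rw [ea, eb]
  exact ENNReal.ofReal_le_ofReal h

variable {N : ℕ} {Ω : Opens (EuclideanSpace ℝ (Fin N))} {f u v : EuclideanSpace ℝ (Fin N) → ℝ}
  {gu gv G : EuclideanSpace ℝ (Fin N) → EuclideanSpace ℝ (Fin N)}

/-- For a test function `φ` there is a function `Z` of `H¹` with compact support which bounds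
`((min (φ⁺) ^ (1 / q) u - v)⁺) ^ q`, and whose energy is controlled by the distance of `φ` from
`u ^ q`. -/
theorem exists_energy_le {q β : ℝ} (hq : 1 < q) (hβ : β = 2 * q - 1)
    (hf0 : ∀ᵐ x ∂(volume.restrict Ω), 0 ≤ f x)
    (hu : IsH1LocGradient Ω u gu) (hv : IsH1LocGradient Ω v gv)
    (hupos : IsPositiveIn Ω u) (hvpos : IsPositiveIn Ω v)
    (hfu : LocallyIntegrableOn (fun x => f x / u x ^ β) Ω)
    (hfv : LocallyIntegrableOn (fun x => f x / v x ^ β) Ω)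
    (hwu : ∀ φ : TestFunction Ω ℝ 1,
      ∫ x in (Ω : Set (EuclideanSpace ℝ (Fin N))), inner ℝ (gu x) (gradient φ x) =
        ∫ x in (Ω : Set (EuclideanSpace ℝ (Fin N))), f x / u x ^ β * φ x)
    (hwv : ∀ φ : TestFunction Ω ℝ 1,
      ∫ x in (Ω : Set (EuclideanSpace ℝ (Fin N))), inner ℝ (gv x) (gradient φ x) =
        ∫ x in (Ω : Set (EuclideanSpace ℝ (Fin N))), f x / v x ^ β * φ x)
    (hU : IsH1LocGradient Ω (fun x => u x ^ q) G)
    (hgG : ∀ᵐ x ∂(volume.restrict Ω), gu x = (1 / q * (u x ^ q) ^ (1 / q - 1)) • G x)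
    (φ : TestFunction Ω ℝ ⊤) :
    ∃ Z ζ, IsH1LocGradient Ω Z ζ ∧ (∀ x, x ∉ tsupport φ → Z x = 0) ∧
      (∀ x, x ∉ tsupport φ → ζ x = 0) ∧
      (∀ᵐ x ∂(volume.restrict (tsupport φ)),
        max (min (max (φ x) 0 ^ (1 / q)) (u x) - v x) 0 ^ q ≤ Z x) ∧
      eLpNorm ζ 2 (volume.restrict (tsupport φ)) ≤
        eLpNorm (fun x => |powerDefect q (φ x) (u x ^ q)| * ‖G x‖ + ‖G x - gradient φ x‖) 2
          (volume.restrict (tsupport φ)) := by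
  have hq0 : 0 < q := by linarith
  have hβ1 : 1 < β := by linarith
  set K := tsupport φ with hKdef
  have hK : IsCompact K := φ.hasCompactSupport.isCompact
  have hKΩ : K ⊆ Ω := φ.tsupport_subset
  obtain ⟨c₁, hc₁, hcu'⟩ := hupos K hK hKΩ
  obtain ⟨c₂, hc₂, hcv'⟩ := hvpos K hK hKΩ
  obtain ⟨c, hc, hcu, hcv⟩ : ∃ c : ℝ, 0 < c ∧ (∀ᵐ x ∂(volume.restrict K), c ≤ u x) ∧
      ∀ᵐ x ∂(volume.restrict K), c ≤ v x :=
    ⟨min c₁ c₂, lt_min hc₁ hc₂, hcu'.mono fun x hx => (min_le_left _ _).trans hx,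
      hcv'.mono fun x hx => (min_le_right _ _).trans hx⟩
  have hd : 0 < c ^ q := by positivity
  obtain ⟨A₀, hA₀⟩ := φ.continuous.bounded_above_of_compact_support φ.hasCompactSupport
  obtain ⟨C, hC⟩ := exists_lipschitzWith_max_rpow hd (r := 1 / q) ((div_le_one hq0).2 hq.le)
  -- `M` exceeds `a`, hence `m`, everywhere: truncation at `M` changes nothing but makes the powers
  -- globally Lipschitz.
  set M : ℝ := max A₀ (c ^ q) ^ (1 / q) + 1 with hM
  have hM0 : 0 < M := by positivity
  set a : EuclideanSpace ℝ (Fin N) → ℝ := fun x => max (φ x) (c ^ q) ^ (1 / q) with ha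
  have haM : ∀ x, a x < M := fun x => by
    have : a x ≤ max A₀ (c ^ q) ^ (1 / q) := by
      refine Real.rpow_le_rpow (by positivity) (max_le_max ?_ le_rfl) (by positivity)
      exact (le_abs_self _).trans (hA₀ x)
    linarith
  have Ha := φ.isH1LocGradient.comp hC (hasDerivWithinAt_max_rpow hd (1 / q))
  have Hu := hu.comp (lipschitzWith_max_const c) (hasDerivWithinAt_max c)
  have Hv := hv.comp (lipschitzWith_max_const c) (hasDerivWithinAt_max c)
  -- The minimum of `max u c` and `a` is written as `s - (s - a)⁺`, so that one-variable chain rules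
  -- and differences suffice.
  have Hm := (Hu.sub ((Hu.sub Ha).comp (lipschitzWith_max_const 0) (hasDerivWithinAt_max 0))).sub Hv
  set m : EuclideanSpace ℝ (Fin N) → ℝ := fun x =>
    max (u x) c - max (max (u x) c - a x) 0 - max (v x) c with hm
  set gm : EuclideanSpace ℝ (Fin N) → EuclideanSpace ℝ (Fin N) := fun x =>
    (if c ≤ u x then (1 : ℝ) else 0) • gu x - (if 0 ≤ max (u x) c - a x then (1 : ℝ) else 0) •
      ((if c ≤ u x then (1 : ℝ) else 0) • gu x -
        (if c ^ q ≤ φ x then 1 / q * φ x ^ (1 / q - 1) else 0) • gradient φ x) -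
      (if c ≤ v x then (1 : ℝ) else 0) • gv x with hgm
  replace Hm : IsH1LocGradient Ω m gm := Hm
  obtain ⟨C₁, hC₁⟩ := exists_lipschitzWith_min_max_rpow hβ1 hM0
  obtain ⟨C₂, hC₂⟩ := exists_lipschitzWith_min_max_rpow hq hM0
  have HΦ := Hm.comp hC₁ (hasDerivWithinAt_min_max_rpow hβ1)
  have HZ := Hm.comp hC₂ (hasDerivWithinAt_min_max_rpow hq)
  have hmin : ∀ x, max (u x) c - max (max (u x) c - a x) 0 = min (a x) (max (u x) c) := by
    intro x
    rcases le_total (a x) (max (u x) c) with h | h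
    · rw [max_eq_left (sub_nonneg.2 h), min_eq_left h]
      ring
    · rw [max_eq_right (sub_nonpos.2 h), min_eq_right h, sub_zero]
  have hm' : ∀ x, m x = min (a x) (max (u x) c) - max (v x) c := fun x => by
    rw [← hmin x]
  have hma : ∀ x, m x ≤ a x := fun x => by
    rw [hm' x]
    linarith [min_le_left (a x) (max (u x) c), le_max_right (v x) c]
  have hmM : ∀ x, m x < M := fun x => (hma x).trans_lt (haM x)
  -- Off the support of `φ`, `a = c ≤ max v c`: the lower truncation at `c` is what confines `m⁺` to
  -- `K`.
  have hoff : ∀ x, x ∉ K → m x ≤ 0 := fun x hx => by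
    have : a x = c := by
      simp only [ha]
      rw [image_eq_zero_of_notMem_tsupport hx, max_eq_right hd.le, one_div,
        Real.rpow_rpow_inv hc.le hq0.ne']
    rw [hm' x]
    linarith [min_le_left (a x) (max (u x) c), le_max_right (v x) c]
  have hoffv : ∀ {p : ℝ}, 1 < p → ∀ x, x ∉ K → min (max (m x) 0) M ^ p = 0 := fun hp x hx => by
    rw [max_eq_right (hoff x hx), min_eq_left hM0.le, Real.zero_rpow (by linarith)]
  have hoffg : ∀ {p : ℝ}, 1 < p → ∀ x, x ∉ K → truncPowDeriv p M (m x) • gm x = 0 :=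
    fun hp x hx => by rw [truncPowDeriv_of_nonpos hp (hoff x hx), zero_smul]
  have hΦ0 : ∀ x, 0 ≤ min (max (m x) 0) M ^ β := fun x => by positivity
  have hΦM : ∀ x, |min (max (m x) 0) M ^ β| ≤ M ^ β := fun x => by
    rw [abs_of_nonneg (hΦ0 x)]
    exact Real.rpow_le_rpow (by positivity) (min_le_right _ _) (by linarith)
  have hf0K : ∀ᵐ x ∂(volume.restrict K), 0 ≤ f x := ae_restrict_of_ae_restrict_of_subset hKΩ hf0
  have hgGK := ae_restrict_of_ae_restrict_of_subset hKΩ hgG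
  have tu := integral_inner_eq_of_forall_testFunction hu.memLp_grad hfu hwu HΦ hK hKΩ
    (hoffv hβ1) (hoffg hβ1) hΦM
  have tv := integral_inner_eq_of_forall_testFunction hv.memLp_grad hfv hwv HΦ hK hKΩ
    (hoffv hβ1) (hoffg hβ1) hΦM
  have hgΦ := HΦ.memLp_grad K hK hKΩ
  have hgZ := HZ.memLp_grad K hK hKΩ
  have hguK := hu.memLp_grad K hK hKΩ
  have hgvK := hv.memLp_grad K hK hKΩ
  have hGK := hU.memLp_grad K hK hKΩ
  have hΦm := (HΦ.memLp_fun K hK hKΩ).1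
  -- Subtract the two tested equations. Almost everywhere on `K`, `m > 0` forces `v ≤ u`, where `f /
  -- u ^ β ≤ f / v ^ β`.
  have test : ∫ x in K, inner ℝ (gu x - gv x) (truncPowDeriv β M (m x) • gm x) ≤ 0 := by
    have i1 : ∀ {h : EuclideanSpace ℝ (Fin N) → ℝ}, LocallyIntegrableOn h Ω →
        IntegrableOn (fun x => h x * min (max (m x) 0) M ^ β) K := fun hh =>
      (hh.integrableOn_compact_subset hKΩ hK).mul_bdd hΦm (Eventually.of_forall hΦM)
    simp_rw [inner_sub_left]
    rw [integral_sub (hguK.integrable_inner_two hgΦ) (hgvK.integrable_inner_two hgΦ), tu, tv,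
      ← integral_sub (i1 hfu) (i1 hfv)]
    refine integral_nonpos_of_ae ?_
    filter_upwards [hcu, hcv, hf0K] with x hxu hxv hxf
    simp only [Pi.zero_apply]
    rw [← sub_mul]
    rcases le_or_gt (m x) 0 with h | h
    · rw [max_eq_right h, min_eq_left hM0.le, Real.zero_rpow (by linarith), mul_zero]
    · refine mul_nonpos_of_nonpos_of_nonneg (sub_nonpos.2 ?_) (hΦ0 x)
      have h1 := hm' x
      rw [max_eq_left hxu, max_eq_left hxv] at h1
      have h2 : v x ≤ u x := by linarith [min_le_right (a x) (u x)]
      have h3 : 0 < v x := hc.trans_le hxv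
      gcongr
  have hρ : MemLp (fun x => |powerDefect q (φ x) (u x ^ q)| * ‖G x‖ + ‖G x - gradient φ x‖) 2
      (volume.restrict K) := by
    have hκ : AEStronglyMeasurable (fun x => powerDefect q (φ x) (u x ^ q))
        (volume.restrict K) :=
      ((measurable_powerDefect q).comp_aemeasurable (φ.continuous.aemeasurable.prodMk
        (hU.memLp_fun K hK hKΩ).1.aemeasurable)).aestronglyMeasurable
    refine MemLp.add ?_ (hGK.sub
      (φ.contDiff_one.continuous_gradient.memLp_restrict_isCompact hK)).norm
    exact hGK.norm.bdd_smul (θ := fun x => |powerDefect q (φ x) (u x ^ q)|) (C := 1) hκ.norm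
      (Eventually.of_forall fun x => by
        rw [abs_abs]
        exact abs_powerDefect_le hq.le _ _)
  refine ⟨_, _, HZ, hoffv hq, hoffg hq, ?_, eLpNorm_two_le_of_integral_sq_le hgZ hρ ?_⟩
  · filter_upwards [hcu, hcv] with x hxu hxv
    rw [min_eq_left (max_le (hmM x).le hM0.le)]
    refine Real.rpow_le_rpow (le_max_right _ _) (max_le_max ?_ le_rfl) hq0.le
    rw [hm' x, max_eq_left hxu, max_eq_left hxv]
    refine sub_le_sub_right (min_le_min ?_ le_rfl) _
    exact Real.rpow_le_rpow (le_max_right _ _) (max_le_max le_rfl hd.le) (by positivity)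
  · have hpt : ∀ᵐ x ∂(volume.restrict K), ‖truncPowDeriv q M (m x) • gm x‖ ^ 2 ≤
        (|powerDefect q (φ x) (u x ^ q)| * ‖G x‖ + ‖G x - gradient φ x‖) ^ 2 +
        2 * q ^ 2 / β * inner ℝ (gu x - gv x) (truncPowDeriv β M (m x) • gm x) := by
      filter_upwards [hcu, hcv, hgGK] with x hxu hxv hxG
      rcases le_or_gt (m x) 0 with h | h
      · rw [truncPowDeriv_of_nonpos hq h, truncPowDeriv_of_nonpos hβ1 h]
        simp only [zero_smul, norm_zero, inner_zero_right, mul_zero, add_zero,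
          zero_pow two_ne_zero]
        positivity
      have h1 := hm' x
      rw [max_eq_left hxu, max_eq_left hxv] at h1
      have hgmx : gm x = gu x - (if 0 ≤ u x - a x then (1 : ℝ) else 0) • (gu x -
          (if c ^ q ≤ φ x then 1 / q * φ x ^ (1 / q - 1) else 0) • gradient φ x) - gv x := by
        simp only [hgm, if_pos hxu, if_pos hxv, one_smul, max_eq_left hxu]
      by_cases hua : 0 ≤ u x - a x
      · rw [if_pos hua, one_smul] at hgmx
        have hau : a x ≤ u x := by linarith
        rw [min_eq_left hau] at h1
        have hca : c < a x := by linarith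
        -- Here `a > v ≥ c`, so the lower truncation of `φ` is inactive and `a = φ ^ (1 / q)`.
        have hcφ : c ^ q < φ x := by
          by_contra hcon
          push Not at hcon
          have : a x = c := by
            simp only [ha]
            rw [max_eq_right hcon, one_div, Real.rpow_rpow_inv hc.le hq0.ne']
          linarith
        have hφ0 : 0 < φ x := hd.trans hcφ
        have hax : a x = φ x ^ (1 / q) := by
          simp only [ha]
          rw [max_eq_left hcφ.le]
        have hφU : φ x ≤ u x ^ q := by
          have := Real.rpow_le_rpow (hc.le.trans hca.le) hau hq0.le
          rwa [hax, one_div, Real.rpow_inv_rpow hφ0.le hq0.ne'] at this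
        rw [if_pos hcφ.le] at hgmx
        refine sq_norm_smul_le hq hβ h (hmM x) (hma x)
          (D := gu x - (1 / q * φ x ^ (1 / q - 1)) • gradient φ x) (by rw [hgmx]; abel) ?_
        rw [hxG, hax, smul_sub_eq_powerDefect hq0 hφ0 hφU]
        refine (norm_add_le _ _).trans (le_of_eq ?_)
        rw [norm_smul, Real.norm_eq_abs]
      · rw [if_neg hua, zero_smul, sub_zero] at hgmx
        refine sq_norm_smul_le hq hβ h (hmM x) (hma x) (D := 0) (by rw [hgmx, add_zero]) ?_
        rw [smul_zero, norm_zero]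
        positivity
    have hi1 := hρ.integrable_sq
    have hi2 := ((hguK.sub hgvK).integrable_inner_two hgΦ).const_mul (2 * q ^ 2 / β)
    have h1 := integral_mono_ae hgZ.norm.integrable_sq (hi1.add hi2) hpt
    have h2 : ∫ x in K, ((|powerDefect q (φ x) (u x ^ q)| * ‖G x‖ + ‖G x - gradient φ x‖) ^ 2 +
        2 * q ^ 2 / β * inner ℝ (gu x - gv x) (truncPowDeriv β M (m x) • gm x)) =
        (∫ x in K, (|powerDefect q (φ x) (u x ^ q)| * ‖G x‖ + ‖G x - gradient φ x‖) ^ 2) +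
        2 * q ^ 2 / β * ∫ x in K, inner ℝ (gu x - gv x) (truncPowDeriv β M (m x) • gm x) := by
      rw [← integral_const_mul]
      exact integral_add hi1 hi2
    have h3 : 2 * q ^ 2 / β *
        ∫ x in K, inner ℝ (gu x - gv x) (truncPowDeriv β M (m x) • gm x) ≤ 0 :=
      mul_nonpos_of_nonneg_of_nonpos (by positivity) test
    simp only [Real.norm_eq_abs, sq_abs]
    refine h1.trans ?_
    refine h2.le.trans ?_
    linarith

end Comparison

/-! ### Comparison and uniqueness. -/

section Uniqueness

variable {N : ℕ} {Ω : Opens (EuclideanSpace ℝ (Fin N))} {f u v : EuclideanSpace ℝ (Fin N) → ℝ}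

/-- The energy bound is applied along test functions tending to `u ^ q`. Only the smaller function
needs its power in `H¹₀`: the approximation of `u ^ q` provides the compact supports, and of `v`
only local information is used. -/
theorem IsSingularSolution.ae_le (hN : 0 < N)
    (hΩ : Bornology.IsBounded (Ω : Set (EuclideanSpace ℝ (Fin N)))) {q β : ℝ} (hq : 1 < q)
    (hβ : β = 2 * q - 1) (hf : IntegrableOn f Ω volume)
    (hf0 : ∀ᵐ x ∂(volume.restrict Ω), 0 ≤ f x) (hu : IsSingularSolution Ω β f u)
    (hv : IsSingularSolution Ω β f v) (hU : MemH10 Ω fun x => u x ^ q) :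
    ∀ᵐ x ∂(volume.restrict Ω), u x ≤ v x := by
  have hq0 : 0 < q := by linarith
  obtain ⟨gu, Hu, hwu⟩ := hu.exists_gradient
  obtain ⟨gv, Hv, hwv⟩ := hv.exists_gradient
  obtain ⟨G, hG, hU2, hG2, ψ, hψ1, hψ2⟩ := hU
  have HU := hG.isH1LocGradient hU2 hG2
  have hu0 := hu.pos.ae_pos
  have hv0 := hv.pos.ae_pos
  have hgG := ae_gradient_eq_of_rpow hq.le hu0 Hu HU
  obtain ⟨ns, hns, hae⟩ := exists_subseq_tendsto_ae
    (fun n => (ψ n).continuous.aestronglyMeasurable) hU2.1 hψ1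
  have hφ2 := hψ2.comp hns.tendsto_atTop
  set φ : ℕ → TestFunction Ω ℝ ⊤ := fun n => ψ (ns n) with hφ
  replace hae : ∀ᵐ x ∂(volume.restrict Ω), Tendsto (fun n => φ n x) atTop (𝓝 (u x ^ q)) := hae
  obtain ⟨R, hR⟩ := hΩ.exists_norm_le
  have hR' : ∀ x ∈ Ω, ‖x‖ ≤ max R 0 := fun x hx => (hR x hx).trans (le_max_left _ _)
  choose Z ζ HZ hZ0 hζ0 hZle hζle using fun n => exists_energy_le hq hβ hf0 Hu Hv hu.pos hv.pos
    (hu.locallyIntegrableOn (by linarith) hf) (hv.locallyIntegrableOn (by linarith) hf) hwu hwv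
    HU hgG (φ n)
  set ρ : ℕ → EuclideanSpace ℝ (Fin N) → ℝ := fun n x =>
    |powerDefect q (φ n x) (u x ^ q)| * ‖G x‖ + ‖G x - gradient (φ n) x‖ with hρ
  have hκ : ∀ n, AEStronglyMeasurable (fun x => powerDefect q (φ n x) (u x ^ q))
      (volume.restrict Ω) := fun n =>
    ((measurable_powerDefect q).comp_aemeasurable ((φ n).continuous.aemeasurable.prodMk
      hU2.1.aemeasurable)).aestronglyMeasurable
  have hκ' : ∀ n, AEStronglyMeasurable (fun x => |powerDefect q (φ n x) (u x ^ q)| * ‖G x‖)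
      (volume.restrict Ω) := fun n => (hκ n).norm.mul hG2.1.norm
  -- The defect is bounded by `1` and tends to `0` almost everywhere, since `φ n / u ^ q → 1`; so
  -- `‖G‖` dominates the first term. The second is the `H¹₀` approximation error.
  have hρ0 : Tendsto (fun n => eLpNorm (ρ n) 2 (volume.restrict Ω)) atTop (𝓝 0) := by
    refine tendsto_eLpNorm_add_zero hκ' (fun n => (hG2.1.sub
      (φ n).contDiff_one.continuous_gradient.aestronglyMeasurable).norm) ?_ ?_
    · refine tendsto_eLpNorm_two_of_dominated (b := fun x => ‖G x‖) hκ' hG2.norm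
        (fun n => Eventually.of_forall fun x => ?_) ?_
      · rw [norm_mul, norm_norm, norm_abs_eq_norm]
        exact mul_le_of_le_one_left (norm_nonneg _) (abs_powerDefect_le hq.le _ _)
      · filter_upwards [hae, hu0] with x hx hx0
        have := (tendsto_powerDefect (q := q) (Real.rpow_pos_of_pos hx0 q) hx).abs.mul_const ‖G x‖
        simpa using this
    · refine hφ2.congr fun n => ?_
      rw [eLpNorm_norm]
      exact eLpNorm_sub_comm _ _ _ _
  have hZlim : Tendsto (fun n => eLpNorm (Z n) 2 (volume.restrict Ω)) atTop (𝓝 0) := by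
    have hb : Tendsto (fun n => ENNReal.ofReal (2 * max R 0) * eLpNorm (ρ n) 2
        (volume.restrict Ω)) atTop (𝓝 0) := by
      simpa using ENNReal.Tendsto.const_mul (a := ENNReal.ofReal (2 * max R 0)) hρ0
        (Or.inr ENNReal.ofReal_ne_top)
    refine tendsto_of_tendsto_of_tendsto_of_le_of_le tendsto_const_nhds hb (fun _ => zero_le)
      (fun n => ?_)
    have hK := (φ n).hasCompactSupport.isCompact
    have hKΩ := (φ n).tsupport_subset
    refine ((HZ n).eLpNorm_le hN (le_max_right R 0) hR' hK hKΩ (hZ0 n) (hζ0 n)).trans ?_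
    gcongr
    rw [eLpNorm_restrict_eq_of_forall_notMem hK hKΩ (hζ0 n)]
    exact (hζle n).trans (eLpNorm_mono_measure _ (Measure.restrict_mono_set _ hKΩ))
  set Y : ℕ → EuclideanSpace ℝ (Fin N) → ℝ := fun n x =>
    max (min (max (φ n x) 0 ^ (1 / q)) (u x) - v x) 0 ^ q with hY
  -- Off the support of `φ n` the minimum is at most `0 < v`, so `Y n` vanishes there.
  have hYle : ∀ n, ∀ᵐ x ∂(volume.restrict Ω), ‖Y n x‖ ≤ ‖Z n x‖ := by
    intro n
    have h1 := (ae_restrict_iff' (φ n).hasCompactSupport.isCompact.measurableSet).1 (hZle n)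
    filter_upwards [ae_restrict_of_ae h1, hv0] with x hx hvx
    have hY0 : 0 ≤ Y n x := Real.rpow_nonneg (le_max_right _ _) _
    rw [Real.norm_of_nonneg hY0]
    by_cases hxK : x ∈ tsupport (φ n)
    · exact (hx hxK).trans (Real.le_norm_self _)
    · have : Y n x = 0 := by
        simp only [hY]
        rw [image_eq_zero_of_notMem_tsupport hxK, max_self, Real.zero_rpow (by positivity),
          max_eq_right (by linarith [min_le_left 0 (u x)]), Real.zero_rpow hq0.ne']
      rw [this]
      exact norm_nonneg _
  have hYlim : Tendsto (fun n => eLpNorm (Y n) 2 (volume.restrict Ω)) atTop (𝓝 0) :=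
    tendsto_of_tendsto_of_tendsto_of_le_of_le tendsto_const_nhds hZlim (fun _ => zero_le)
      fun n => eLpNorm_mono_ae (hYle n)
  have hum : AEMeasurable u (volume.restrict Ω) :=
    Hu.isWeakGradient.locallyIntegrableOn_fun.aestronglyMeasurable.aemeasurable
  have hvm : AEMeasurable v (volume.restrict Ω) :=
    Hv.isWeakGradient.locallyIntegrableOn_fun.aestronglyMeasurable.aemeasurable
  have hYm : ∀ n, AEStronglyMeasurable (Y n) (volume.restrict Ω) := fun n =>
    ((((((φ n).continuous.aemeasurable.max aemeasurable_const).pow_const _).min hum).sub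
      hvm).max aemeasurable_const |>.pow_const q).aestronglyMeasurable
  have hYae : ∀ᵐ x ∂(volume.restrict Ω),
      Tendsto (fun n => Y n x) atTop (𝓝 (max (u x - v x) 0 ^ q)) := by
    filter_upwards [hae, hu0] with x hx hx0
    have h1 : Tendsto (fun n => max (φ n x) 0 ^ (1 / q)) atTop (𝓝 (u x)) := by
      have := (hx.max (tendsto_const_nhds (x := (0 : ℝ)))).rpow_const (p := 1 / q)
        (Or.inr (by positivity))
      have e : max (u x ^ q) 0 ^ (1 / q) = u x := by
        rw [max_eq_left (Real.rpow_nonneg hx0.le _), one_div, Real.rpow_rpow_inv hx0.le hq0.ne']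
      rwa [e] at this
    have h2 := (((h1.min (tendsto_const_nhds (x := u x))).sub_const (v x)).max
      (tendsto_const_nhds (x := (0 : ℝ)))).rpow_const (p := q) (Or.inr hq0.le)
    rwa [min_self] at h2
  -- Fatou: the almost everywhere limit of `Y n` has norm at most the lower limit of the norms,
  -- which is `0`.
  have hfatou := Lp.eLpNorm_lim_le_liminf_eLpNorm (p := 2) hYm _ hYae
  have hmeas : AEStronglyMeasurable (fun x => max (u x - v x) 0 ^ q) (volume.restrict Ω) :=
    (((hum.sub hvm).max aemeasurable_const).pow_const q).aestronglyMeasurable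
  rw [hYlim.liminf_eq, nonpos_iff_eq_zero, eLpNorm_eq_zero_iff hmeas two_ne_zero] at hfatou
  filter_upwards [hfatou] with x hx
  have h1 : max (u x - v x) 0 = 0 :=
    ((Real.rpow_eq_zero (le_max_right _ _) hq0.ne').1 hx)
  linarith [le_max_left (u x - v x) 0]

/-- Two solutions in the class coincide. -/
theorem IsSingularSolution.ae_eq (hN : 0 < N)
    (hΩ : Bornology.IsBounded (Ω : Set (EuclideanSpace ℝ (Fin N)))) {β : ℝ} (hβ : 1 < β)
    (hf : IntegrableOn f Ω volume) (hf0 : ∀ᵐ x ∂(volume.restrict Ω), 0 ≤ f x)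
    (hu : IsSingularSolution Ω β f u) (huc : InBoccardoOrsinaClass Ω β u)
    (hv : IsSingularSolution Ω β f v) (hvc : InBoccardoOrsinaClass Ω β v) :
    u =ᵐ[volume.restrict Ω] v := by
  have hq : 1 < max 1 ((β + 1) / 2) := lt_max_of_lt_right (by linarith)
  -- Since `β > 1`, the maximum is `(β + 1) / 2`.
  have hβq : β = 2 * max 1 ((β + 1) / 2) - 1 := by
    rw [max_eq_right (by linarith)]
    ring
  filter_upwards [hu.ae_le hN hΩ hq hβq hf hf0 hv huc.2, hv.ae_le hN hΩ hq hβq hf hf0 hu hvc.2]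
    with x h1 h2
  exact le_antisymm h1 h2

end Uniqueness

theorem theorem1p3 {N : ℕ} (hN : 0 < N) (Ω : Opens (EuclideanSpace ℝ (Fin N)))
    (hΩ : Bornology.IsBounded (Ω : Set (EuclideanSpace ℝ (Fin N))))
    (β : ℝ) (hβ : 1 < β) (f : EuclideanSpace ℝ (Fin N) → ℝ)
    (hf : IntegrableOn f Ω volume)
    (hf0 : ∀ᵐ x ∂(volume.restrict (Ω : Set (EuclideanSpace ℝ (Fin N)))), 0 ≤ f x) :
    -- nonnegative functions of the class vanish on the boundary
    (∀ u : EuclideanSpace ℝ (Fin N) → ℝ,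
      (∀ᵐ x ∂(volume.restrict (Ω : Set (EuclideanSpace ℝ (Fin N)))), 0 ≤ u x) →
      InBoccardoOrsinaClass Ω β u → VanishesOnBoundary Ω u) ∧
    -- two solutions in the class coincide
    (∀ u v : EuclideanSpace ℝ (Fin N) → ℝ,
      IsSingularSolution Ω β f u → InBoccardoOrsinaClass Ω β u →
      IsSingularSolution Ω β f v → InBoccardoOrsinaClass Ω β v →
      u =ᵐ[volume.restrict (Ω : Set (EuclideanSpace ℝ (Fin N)))] v) ∧
    -- a Boccardo–Orsina solution is, up to null sets, the only solution in the class
    (∀ u : EuclideanSpace ℝ (Fin N) → ℝ, IsBoccardoOrsinaSolution Ω β f u →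
      VanishesOnBoundary Ω u ∧
      ∀ v : EuclideanSpace ℝ (Fin N) → ℝ,
        (IsSingularSolution Ω β f v ∧ InBoccardoOrsinaClass Ω β v) ↔
          v =ᵐ[volume.restrict (Ω : Set (EuclideanSpace ℝ (Fin N)))] u) := by
  refine ⟨fun u hu0 hu => hu.vanishesOnBoundary hΩ hu0,
    fun u v hu huc hv hvc => hu.ae_eq hN hΩ hβ hf hf0 huc hv hvc, fun u hu => ?_⟩
  refine ⟨hu.inClass.vanishesOnBoundary hΩ (hu.isSolution.pos.ae_pos.mono fun _ h => h.le),
    fun v => ⟨fun hv => hv.1.ae_eq hN hΩ hβ hf hf0 hv.2 hu.isSolution hu.inClass,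
      fun hvu => ⟨hu.isSolution.congr hvu, hu.inClass.congr hvu⟩⟩⟩
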